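/- Let $n\ge 1$, $0<s<1$, and let $K\subset\mathbb R^n$ be a convex body (compact, convex, with non-empty interior) that is strictly convex (for $x\ne y$ in $K$ and $0<\lambda<1$, $(1-\lambda)x+\lambda y\in\operatorname{int}K$) and unconditional (symmetric with respect to every coordinate hyperplane). Let $\|\cdot\|_K$ be the norm with closed unit ball $K$. For a Borel set $E\subseteq\mathbb R^n$ with Lebesgue measure $|E|$ put $$P_s(E,K)=\int_E\int_{E^c}\frac{dy\,dx}{\|x-y\|_K^{n+s}},\qquad \gamma_{n,s}(K)=\inf\Bigl\{P_s(E,K)\,|E|^{-\frac{n-s}{n}} : E \text{ bounded Borel},\ |E|>0\Bigr\},$$ and for measurable $f$ put $[f]_{s,1,K}=\int_{\mathbb R^n}\int_{\mathbb R^n}\frac{|f(x)-f(y)|}{\|x-y\|_K^{n+s}}\,dy\,dx\in[0,\infty]$. Let $M$ be a minimizer of the anisotropic fractional isoperimetric inequality, i.e. a bounded Borel set with $|M|>0$ and $P_s(M,K)=\gamma_{n,s}(K)|M|^{\frac{n-s}{n}}$. A star body is a bounded set $L$, star-shaped with respect to the origin, with the origin in its interior, whose radial function $\rho_L(x)=\sup\{\lambda\ge0:\lambda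 x\in L\}$ is continuous on $\mathbb R^n\setminus\{0\}$. For a star body $L$ and $E\subseteq\mathbb R^n$ let $E^L=\mathbb R^n$ if $|E|=\infty$, and otherwise $E^L=rL$ where $r\ge0$ is such that $|rL|=|E|$; for $f\in L^1(\mathbb R^n)$ (real-valued) let $f^L(x)=\sup\{\tau>0: x\in\{|f|>\tau\}^L\}\in[0,\infty]$, with $\sup\emptyset=0$. Then the rearrangement $f^M$ is well defined and does not increase the seminorm, in the following sense. 1. Up to translation and a set of measure zero, $M$ is an unconditional star body: there are an unconditional star body $L$ and $c\in\mathbb R^n$ such that $M$ and $c+L$ differ by a null set. 2. If $L$ and $L'$ are two unconditional star bodies each having a translate that differs from $M$ by a null set, then $f^{L}=f^{L'}$ almost everywhere for all $f\in L^1(\mathbb R^n)$. 3. For every star body $L$ having a translate that differs from $M$ by a null set: for every $E$ with $|E|<\infty$ there is exactly one $r\ge0$ with $|rL|=|E|$; and for every $f\in L^1(\mathbb R^n)$ the function $f^L$ is Lebesgue measurable and finite at every $x\ne0$, and $$\int_{\mathbb R^n}\int_{\mathbb R^n}\frac{|f(x)-f(y)|}{\|x-y\|_K^{n+s}}\,dy\,dx\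 \ge\ \int_{\mathbb R^n}\int_{\mathbb R^n}\frac{|f^L(x)-f^L(y)|}{\|x-y\|_K^{n+s}}\,dy\,dx .$$ -/

import Mathlib

open MeasureTheory
open scoped ENNReal Pointwise

namespace FracPS

/-- Reflection in the coordinate hyperplane where the `i`-th coordinate vanishes. -/
def coordReflection {n : ℕ} (i : Fin n) (x : EuclideanSpace ℝ (Fin n)) :
    EuclideanSpace ℝ (Fin n) :=
  WithLp.toLp 2 (fun j => if j = i then -x j else x j)

/-- A set that is symmetric with respect to every coordinate hyperplane. -/
def IsUnconditional {n : ℕ} (S : Set (EuclideanSpace ℝ (Fin n))) : Prop :=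
  ∀ i : Fin n, ∀ x ∈ S, coordReflection i x ∈ S

/-- Convex bodies: compact convex sets with nonempty interior. -/
structure IsConvexBody {n : ℕ} (K : Set (EuclideanSpace ℝ (Fin n))) : Prop where
  isCompact : IsCompact K
  convex : Convex ℝ K
  nonempty_interior : (interior K).Nonempty

/-- The anisotropic fractional `s`-perimeter of `E`, with values in `[0, ∞]`. For an
origin-symmetric convex body `K`, `gauge K` is the norm with closed unit ball `K`. -/
noncomputable def fracPerimeter {n : ℕ} (s : ℝ) (K E : Set (EuclideanSpace ℝ (Fin n))) : ℝ≥0∞ :=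
  ∫⁻ x in E, ∫⁻ y in Eᶜ, ENNReal.ofReal (1 / gauge K (x - y) ^ ((n : ℝ) + s))

/-- The optimal constant of the anisotropic fractional isoperimetric inequality: the infimum of
`P_s(E, K) / |E| ^ ((n - s) / n)` over all bounded Borel sets `E` of positive measure. -/
noncomputable def isoConst {n : ℕ} (s : ℝ) (K : Set (EuclideanSpace ℝ (Fin n))) : ℝ≥0∞ :=
  sInf {q : ℝ≥0∞ | ∃ E : Set (EuclideanSpace ℝ (Fin n)),
    MeasurableSet E ∧ Bornology.IsBounded E ∧ 0 < volume E ∧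
      q = fracPerimeter s K E / volume E ^ (((n : ℝ) - s) / n)}

/-- Minimizers of the anisotropic fractional isoperimetric inequality: bounded Borel sets of
positive measure for which equality holds with the optimal constant. -/
structure IsMinimizer {n : ℕ} (s : ℝ) (K M : Set (EuclideanSpace ℝ (Fin n))) : Prop where
  measurableSet : MeasurableSet M
  isBounded : Bornology.IsBounded M
  volume_pos : 0 < volume M
  eq_isoConst : fracPerimeter s K M = isoConst s K * volume M ^ (((n : ℝ) - s) / n)

/-- The radial function; it is only used for bounded star-shaped sets and at `x ≠ 0`. -/
noncomputable def radialFun {n : ℕ} (L : Set (EuclideanSpace ℝ (Fin n)))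
    (x : EuclideanSpace ℝ (Fin n)) : ℝ :=
  sSup {t : ℝ | 0 ≤ t ∧ t • x ∈ L}

/-- Star bodies: bounded sets, star-shaped with respect to the origin, with the origin in the
interior and with continuous radial function. -/
structure IsStarBody {n : ℕ} (L : Set (EuclideanSpace ℝ (Fin n))) : Prop where
  isBounded : Bornology.IsBounded L
  starConvex : StarConvex ℝ 0 L
  zero_mem_interior : (0 : EuclideanSpace ℝ (Fin n)) ∈ interior L
  continuousOn_radialFun : ContinuousOn (radialFun L) {0}ᶜ

/-- `M` agrees with a translate of `L` up to a Lebesgue null set. -/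
def EquivTranslate {n : ℕ} (M L : Set (EuclideanSpace ℝ (Fin n))) : Prop :=
  ∃ c : EuclideanSpace ℝ (Fin n), M =ᵐ[volume] ((fun x => c + x) '' L)

open Classical in
/-- The symmetrization of the set `E` with respect to the star body `L`: the whole space if `E`
has infinite measure, and otherwise the dilate `r • L`, `r ≥ 0`, with the same measure as `E`. -/
noncomputable def symmSet {n : ℕ} (L E : Set (EuclideanSpace ℝ (Fin n))) :
    Set (EuclideanSpace ℝ (Fin n)) :=
  if volume E = ∞ then Set.univ
  else {x | ∃ r : ℝ, 0 ≤ r ∧ volume (r • L) = volume E ∧ x ∈ r • L}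

/-- The symmetrization of the function `f` with respect to the star body `L`,
`x ↦ sup {τ > 0 | x ∈ {|f| > τ}^L}`, with values in `[0, ∞]` (and `sup ∅ = 0`). -/
noncomputable def symmFun {n : ℕ} (L : Set (EuclideanSpace ℝ (Fin n)))
    (f : EuclideanSpace ℝ (Fin n) → ℝ) (x : EuclideanSpace ℝ (Fin n)) : ℝ≥0∞ :=
  sSup {t : ℝ≥0∞ | ∃ τ : ℝ, 0 < τ ∧ x ∈ symmSet L {y | τ < |f y|} ∧ t = ENNReal.ofReal τ}

/-- The anisotropic fractional `W^{s,1}` seminorm with respect to `K`, with values in `[0, ∞]`. -/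
noncomputable def fracSeminorm {n : ℕ} (s : ℝ) (K : Set (EuclideanSpace ℝ (Fin n)))
    (f : EuclideanSpace ℝ (Fin n) → ℝ) : ℝ≥0∞ :=
  ∫⁻ x, ∫⁻ y, ENNReal.ofReal (|f x - f y| / gauge K (x - y) ^ ((n : ℝ) + s))

end FracPS

namespace FracPS


/-! ### Coordinate reflections and sign changes -/

/-! The seminorm inequality rests on a coarea formula: the seminorm of a nonnegative function is
twice the integral over t > 0 of the perimeters of its superlevel sets
(`fracSeminorm_eq_lintegral_fracPerimeter`). Passing from f to |f| does not increase the seminorm,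
and the superlevel sets of the rearrangement are, up to null sets, dilates of L with the volumes of
those of |f| (`IsOptimalShape.superlevel_ae_eq`). Since P_s and |·|^((n-s)/n) scale alike, every
dilate of L is again optimal, so the isoperimetric inequality can be applied level by level. The
optimal constant is an infimum over bounded sets only, whereas superlevel sets merely have finite
measure; `isoConst_mul_le` closes this gap by truncating with balls of averaged radius.

The shape of M comes from polarization in coordinate hyperplanes. Strict convexity and
unconditionality make the kernel strictly larger at x - y than at x minus the reflection of y, when
x ≠ y lie on the same side. Polarization therefore keeps the volume and does not raise the
perimeter, and if the perimeter is finite and unchanged, the set is comparable to its reflection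
(`reflection_comparable_of_le_polarization`). A minimizer and all its translates have this property.
Centring M at its coordinate medians turns comparability into symmetry (`IsMinimizer.ae_symmetric`);
comparing with reflections in shifted hyperplanes gives monotonicity in each |x_i|
(`IsMinimizer.ae_monotone`). A Fubini argument replaces M by an open set that contains, with each
point, the whole coordinate box it spans (`ae_eq_boxRep`), and such sets are star bodies when
bounded and nonempty (`IsBoxMonotone.isStarBody`).

Two unconditional representatives agree almost everywhere, because a nonzero relative shift would
make a bounded set of positive measure invariant under a translation (`ae_eq_of_equivTranslate`). -/

theorem coordReflection_apply {n : ℕ} (i j : Fin n) (x : EuclideanSpace ℝ (Fin n)) :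
    coordReflection i x j = if j = i then -x j else x j := rfl

@[simp] theorem coordReflection_same {n : ℕ} (i : Fin n) (x : EuclideanSpace ℝ (Fin n)) :
    coordReflection i x i = -x i := by simp [coordReflection_apply]

@[simp] theorem coordReflection_involutive {n : ℕ} (i : Fin n) (x : EuclideanSpace ℝ (Fin n)) :
    coordReflection i (coordReflection i x) = x := by
  ext j
  by_cases h : j = i <;> simp [coordReflection_apply, h]

/-- The coordinate reflection as a linear isometry. -/
noncomputable def reflIso {n : ℕ} (i : Fin n) :
    EuclideanSpace ℝ (Fin n) ≃ₗᵢ[ℝ] EuclideanSpace ℝ (Fin n) where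
  toFun := coordReflection i
  invFun := coordReflection i
  left_inv := coordReflection_involutive i
  right_inv := coordReflection_involutive i
  map_add' x y := by
    ext j
    by_cases h : j = i <;> simp [coordReflection_apply, h, add_comm]
  map_smul' c x := by
    ext j
    by_cases h : j = i <;> simp [coordReflection_apply, h]
  norm_map' x := by
    change ‖coordReflection i x‖ = ‖x‖
    rw [EuclideanSpace.norm_eq, EuclideanSpace.norm_eq]
    congr 1
    refine Finset.sum_congr rfl fun j _ => ?_
    by_cases h : j = i <;> simp [coordReflection_apply, h]

theorem coordReflection_sub {n : ℕ} (i : Fin n) (x y : EuclideanSpace ℝ (Fin n)) :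
    coordReflection i (x - y) = coordReflection i x - coordReflection i y :=
  map_sub (reflIso i) x y

theorem coordReflection_add {n : ℕ} (i : Fin n) (x y : EuclideanSpace ℝ (Fin n)) :
    coordReflection i (x + y) = coordReflection i x + coordReflection i y :=
  map_add (reflIso i) x y

theorem norm_coordReflection {n : ℕ} (i : Fin n) (x : EuclideanSpace ℝ (Fin n)) :
    ‖coordReflection i x‖ = ‖x‖ := (reflIso i).norm_map x

theorem measurePreserving_coordReflection {n : ℕ} (i : Fin n) :
    MeasurePreserving (coordReflection i (n := n)) volume volume :=
  (reflIso i).measurePreserving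

/-- Change of the signs of the coordinates in `S`. -/
noncomputable def signFlip {n : ℕ} (S : Finset (Fin n)) (x : EuclideanSpace ℝ (Fin n)) :
    EuclideanSpace ℝ (Fin n) :=
  WithLp.toLp 2 (fun j => if j ∈ S then -x j else x j)

theorem signFlip_apply {n : ℕ} (S : Finset (Fin n)) (x : EuclideanSpace ℝ (Fin n)) (j : Fin n) :
    signFlip S x j = if j ∈ S then -x j else x j := rfl

@[simp] theorem signFlip_empty {n : ℕ} (x : EuclideanSpace ℝ (Fin n)) : signFlip ∅ x = x := by
  ext j; simp [signFlip_apply]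

theorem signFlip_univ {n : ℕ} (x : EuclideanSpace ℝ (Fin n)) : signFlip Finset.univ x = -x := by
  ext j; simp [signFlip_apply]

theorem signFlip_insert {n : ℕ} {S : Finset (Fin n)} {i : Fin n} (hi : i ∉ S)
    (x : EuclideanSpace ℝ (Fin n)) :
    signFlip (insert i S) x = coordReflection i (signFlip S x) := by
  ext j
  by_cases h : j = i
  · subst h; simp [signFlip_apply, hi]
  · simp [signFlip_apply, coordReflection_apply, h]

theorem IsUnconditional.signFlip_mem {n : ℕ} {K : Set (EuclideanSpace ℝ (Fin n))}
    (hK : IsUnconditional K) (S : Finset (Fin n)) {x : EuclideanSpace ℝ (Fin n)} (hx : x ∈ K) :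
    signFlip S x ∈ K := by
  induction S using Finset.induction_on with
  | empty => simpa
  | insert i S hi ih => rw [signFlip_insert hi]; exact hK i _ ih

theorem IsUnconditional.neg_mem {n : ℕ} {K : Set (EuclideanSpace ℝ (Fin n))}
    (hK : IsUnconditional K) {x : EuclideanSpace ℝ (Fin n)} (hx : x ∈ K) : -x ∈ K := by
  rw [← signFlip_univ]; exact hK.signFlip_mem _ hx

theorem IsUnconditional.mem_iff {n : ℕ} {K : Set (EuclideanSpace ℝ (Fin n))}
    (hK : IsUnconditional K) (i : Fin n) (x : EuclideanSpace ℝ (Fin n)) :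
    coordReflection i x ∈ K ↔ x ∈ K :=
  ⟨fun h => by simpa using hK i _ h, hK i x⟩

/-! ### The gauge of an unconditional convex body -/

/-- The origin is the midpoint of an interior point p and of -p, which lies in K by
unconditionality. -/
theorem IsConvexBody.mem_nhds_zero {n : ℕ} {K : Set (EuclideanSpace ℝ (Fin n))}
    (hK : IsConvexBody K) (hKu : IsUnconditional K) : K ∈ nhds 0 := by
  obtain ⟨p, hp⟩ := hK.nonempty_interior
  have hneg : -p ∈ K := hKu.neg_mem (interior_subset hp)
  have h : (1 / 2 : ℝ) • p + (1 / 2 : ℝ) • (-p) ∈ interior K :=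
    hK.convex.combo_interior_self_mem_interior hp hneg (by norm_num) (by norm_num) (by norm_num)
  rw [smul_neg, add_neg_cancel] at h
  exact mem_interior_iff_mem_nhds.1 h

theorem IsConvexBody.gauge_pos {n : ℕ} {K : Set (EuclideanSpace ℝ (Fin n))}
    (hK : IsConvexBody K) (hKu : IsUnconditional K) {x : EuclideanSpace ℝ (Fin n)} (hx : x ≠ 0) :
    0 < gauge K x :=
  (_root_.gauge_pos (absorbent_nhds_zero (hK.mem_nhds_zero hKu))
    ((NormedSpace.isVonNBounded_iff ℝ).2 hK.isCompact.isBounded)).2 hx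

theorem IsConvexBody.continuous_gauge {n : ℕ} {K : Set (EuclideanSpace ℝ (Fin n))}
    (hK : IsConvexBody K) (hKu : IsUnconditional K) : Continuous (gauge K) :=
  _root_.continuous_gauge hK.convex (hK.mem_nhds_zero hKu)

theorem IsUnconditional.gauge_neg {n : ℕ} {K : Set (EuclideanSpace ℝ (Fin n))}
    (hKu : IsUnconditional K) (x : EuclideanSpace ℝ (Fin n)) : gauge K (-x) = gauge K x :=
  _root_.gauge_neg (fun _ h => hKu.neg_mem h) x

theorem IsUnconditional.gauge_coordReflection {n : ℕ} {K : Set (EuclideanSpace ℝ (Fin n))}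
    (hKu : IsUnconditional K) (i : Fin n) (x : EuclideanSpace ℝ (Fin n)) :
    gauge K (coordReflection i x) = gauge K x := by
  rw [gauge_def', gauge_def']
  congr 1
  ext r
  have : r⁻¹ • coordReflection i x = coordReflection i (r⁻¹ • x) :=
    ((reflIso i).map_smul r⁻¹ x).symm
  rw [Set.mem_sep_iff, Set.mem_sep_iff, this, hKu.mem_iff]

theorem IsConvexBody.exists_norm_le_gauge {n : ℕ} {K : Set (EuclideanSpace ℝ (Fin n))}
    (hK : IsConvexBody K) (hKu : IsUnconditional K) :
    ∃ R : ℝ, 0 < R ∧ ∀ x, ‖x‖ ≤ R * gauge K x := by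
  obtain ⟨R, hR, h⟩ := hK.isCompact.isBounded.subset_closedBall_lt 0 0
  refine ⟨R, hR, fun x => ?_⟩
  have := le_gauge_of_subset_closedBall (x := x) (absorbent_nhds_zero (hK.mem_nhds_zero hKu)) hR.le h
  rwa [div_le_iff₀' hR] at this

/-- Strict monotonicity of the gauge in the modulus of one coordinate. -/
theorem IsConvexBody.gauge_lt_gauge {n : ℕ} {K : Set (EuclideanSpace ℝ (Fin n))}
    (hK : IsConvexBody K) (hKu : IsUnconditional K) (hKs : StrictConvex ℝ K) (i : Fin n)
    {z w : EuclideanSpace ℝ (Fin n)} (hzw : ∀ j, j ≠ i → z j = w j) (hi : |z i| < |w i|) :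
    gauge K z < gauge K w := by
  have hwi : w i ≠ 0 := fun h => by rw [h, abs_zero] at hi; exact absurd hi (not_lt.2 (abs_nonneg _))
  have hw : w ≠ 0 := fun h => hwi (by simp [h])
  have hg := hK.gauge_pos hKu hw
  set g := gauge K w with hgdef
  have hmem : ∀ v, gauge K v = g → g⁻¹ • v ∈ K := by
    intro v hv
    have h1 : gauge K (g⁻¹ • v) ≤ 1 := by
      rw [gauge_smul_of_nonneg (inv_nonneg.2 hg.le), hv, smul_eq_mul, inv_mul_cancel₀ hg.ne']
    rw [gauge_le_one_iff_mem_closure hK.convex (hK.mem_nhds_zero hKu)] at h1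
    rwa [hK.isCompact.isClosed.closure_eq] at h1
  have h1 := hmem w rfl
  have h2 := hmem (coordReflection i w) (hKu.gauge_coordReflection i w)
  have hne : g⁻¹ • w ≠ g⁻¹ • coordReflection i w := by
    intro h
    have := congrArg (fun v : EuclideanSpace ℝ (Fin n) => v i) h
    simp only [PiLp.smul_apply, smul_eq_mul, coordReflection_same] at this
    have := mul_left_cancel₀ (inv_ne_zero hg.ne') this
    exact hwi (by linarith)
  -- The weight for which z is the convex combination of w and its reflection. Both have gauge g, so
  -- strict convexity places z / g in the interior of K.
  set a : ℝ := (1 + z i / w i) / 2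
  have hq : |z i / w i| < 1 := by
    rw [abs_div, div_lt_one (abs_pos.2 hwi)]; exact hi
  rw [abs_lt] at hq
  have ha : 0 < a := by simp only [a]; linarith [hq.1]
  have hb : 0 < 1 - a := by simp only [a]; linarith [hq.2]
  have h3 := hKs h1 h2 hne ha hb (by ring)
  have h4 : a • g⁻¹ • w + (1 - a) • g⁻¹ • coordReflection i w = g⁻¹ • z := by
    ext j
    simp only [PiLp.add_apply, PiLp.smul_apply, smul_eq_mul, coordReflection_apply]
    by_cases h : j = i
    · subst h
      simp only [if_true, a]
      field_simp
      ring
    · rw [if_neg h, hzw j h]; ring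
  rw [h4] at h3
  have h5 : gauge K (g⁻¹ • z) < 1 := interior_subset_gauge_lt_one K h3
  rw [gauge_smul_of_nonneg (inv_nonneg.2 hg.le), smul_eq_mul, inv_mul_lt_iff₀ hg, mul_one] at h5
  exact h5

/-! ### The kernel -/

/-- The kernel of the anisotropic fractional perimeter. -/
noncomputable def kernel {n : ℕ} (s : ℝ) (K : Set (EuclideanSpace ℝ (Fin n)))
    (z : EuclideanSpace ℝ (Fin n)) : ℝ≥0∞ :=
  ENNReal.ofReal (1 / gauge K z ^ ((n : ℝ) + s))

theorem measurable_kernel {n : ℕ} (s : ℝ) {K : Set (EuclideanSpace ℝ (Fin n))}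
    (hK : IsConvexBody K) (hKu : IsUnconditional K) : Measurable (kernel s K) := by
  have := (hK.continuous_gauge hKu).measurable
  unfold kernel
  fun_prop

theorem kernel_neg {n : ℕ} (s : ℝ) {K : Set (EuclideanSpace ℝ (Fin n))}
    (hKu : IsUnconditional K) (z : EuclideanSpace ℝ (Fin n)) :
    kernel s K (-z) = kernel s K z := by
  rw [kernel, kernel, hKu.gauge_neg]

theorem kernel_sub_comm {n : ℕ} (s : ℝ) {K : Set (EuclideanSpace ℝ (Fin n))}
    (hKu : IsUnconditional K) (x y : EuclideanSpace ℝ (Fin n)) :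
    kernel s K (x - y) = kernel s K (y - x) := by
  rw [← kernel_neg s hKu, neg_sub]

theorem kernel_coordReflection {n : ℕ} (s : ℝ) {K : Set (EuclideanSpace ℝ (Fin n))}
    (hKu : IsUnconditional K) (i : Fin n) (z : EuclideanSpace ℝ (Fin n)) :
    kernel s K (coordReflection i z) = kernel s K z := by
  rw [kernel, kernel, hKu.gauge_coordReflection]

theorem kernel_smul {n : ℕ} {s : ℝ} {K : Set (EuclideanSpace ℝ (Fin n))}
    {r : ℝ} (hr : 0 < r) (z : EuclideanSpace ℝ (Fin n)) :
    kernel s K (r • z) = ENNReal.ofReal (r ^ (-((n : ℝ) + s))) * kernel s K z := by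
  rw [kernel, kernel, gauge_smul_of_nonneg hr.le, smul_eq_mul,
    Real.mul_rpow hr.le (gauge_nonneg _), ← ENNReal.ofReal_mul (by positivity), Real.rpow_neg hr.le]
  congr 1
  field_simp

theorem kernel_lt_top {n : ℕ} {s : ℝ} {K : Set (EuclideanSpace ℝ (Fin n))}
    (z : EuclideanSpace ℝ (Fin n)) : kernel s K z < ∞ := ENNReal.ofReal_lt_top

theorem kernel_lt_kernel {n : ℕ} {s : ℝ} (hs : 0 < s) {K : Set (EuclideanSpace ℝ (Fin n))}
    (hK : IsConvexBody K) (hKu : IsUnconditional K) (hKs : StrictConvex ℝ K) (i : Fin n)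
    {z w : EuclideanSpace ℝ (Fin n)} (hz : z ≠ 0) (hzw : ∀ j, j ≠ i → z j = w j)
    (hi : |z i| < |w i|) : kernel s K w < kernel s K z := by
  have h := hK.gauge_lt_gauge hKu hKs i hzw hi
  have h0 := hK.gauge_pos hKu hz
  have hn : (0 : ℝ) < n + s := by positivity
  refine (ENNReal.ofReal_lt_ofReal_iff (by positivity)).2 ?_
  exact one_div_lt_one_div_of_lt (Real.rpow_pos_of_pos h0 _) (Real.rpow_lt_rpow h0.le h hn)

theorem exists_kernel_le {n : ℕ} {s : ℝ} (hs : 0 < s) {K : Set (EuclideanSpace ℝ (Fin n))}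
    (hK : IsConvexBody K) (hKu : IsUnconditional K) :
    ∃ C : ℝ, 0 ≤ C ∧ ∀ z, z ≠ 0 → kernel s K z ≤ ENNReal.ofReal (C * ‖z‖ ^ (-((n : ℝ) + s))) := by
  obtain ⟨R, hR, h⟩ := hK.exists_norm_le_gauge hKu
  have hn : (0 : ℝ) < n + s := by positivity
  refine ⟨R ^ ((n : ℝ) + s), by positivity, fun z hz => ENNReal.ofReal_le_ofReal ?_⟩
  have hz' : 0 < ‖z‖ := norm_pos_iff.2 hz
  have h0 := hK.gauge_pos hKu hz
  rw [Real.rpow_neg hz'.le, div_le_iff₀ (by positivity), mul_right_comm,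
    ← Real.mul_rpow hR.le h0.le, ← div_eq_mul_inv, le_div_iff₀ (by positivity), one_mul]
  exact Real.rpow_le_rpow hz'.le (h z) hn.le

/-- Integrability of the kernel against `min ‖z‖ 1`. -/
theorem lintegral_min_norm_mul_kernel_lt_top {n : ℕ} (hn : 1 ≤ n) {s : ℝ} (hs0 : 0 < s)
    (hs1 : s < 1) {K : Set (EuclideanSpace ℝ (Fin n))}
    (hK : IsConvexBody K) (hKu : IsUnconditional K) :
    ∫⁻ z, ENNReal.ofReal (min ‖z‖ 1) * kernel s K z < ∞ := by
  obtain ⟨C, hC, hk⟩ := exists_kernel_le hs0 hK hKu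
  have : Nonempty (Fin n) := ⟨⟨0, hn⟩⟩
  set f : ℝ → ℝ := fun r => min r 1 * (C * r ^ (-((n : ℝ) + s))) with hf
  have hint : Integrable (fun z : EuclideanSpace ℝ (Fin n) => f ‖z‖) := by
    -- With the polar weight r^(n-1) the integrand is C r^(-s) on (0,1], integrable since s < 1, and
    -- C r^(-1-s) on (1,∞), integrable since s > 0.
    rw [integrable_fun_norm_addHaar volume, finrank_euclideanSpace, Fintype.card_fin]
    have hsplit : Set.Ioi (0 : ℝ) = Set.Ioc 0 1 ∪ Set.Ioi 1 :=
      (Set.Ioc_union_Ioi_eq_Ioi zero_le_one).symm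
    rw [hsplit]
    refine IntegrableOn.union ?_ ?_
    · have h1 : IntegrableOn (fun y : ℝ => C * y ^ (-s)) (Set.Ioc 0 1) := by
        rw [integrableOn_Ioc_iff_integrableOn_Ioo]
        exact ((intervalIntegral.integrableOn_Ioo_rpow_iff one_pos).2 (by linarith)).const_mul C
      refine h1.congr_fun ?_ measurableSet_Ioc
      intro y hy
      simp only [hf, smul_eq_mul]
      rw [min_eq_left hy.2]
      have : y ^ (-s) = y ^ (n - 1) * (y * y ^ (-((n : ℝ) + s))) := by
        rw [← mul_assoc, ← pow_succ, Nat.sub_add_cancel hn, ← Real.rpow_natCast,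
          ← Real.rpow_add hy.1]
        congr 1; ring
      rw [this]; ring
    · have h1 : IntegrableOn (fun y : ℝ => C * y ^ (-1 - s)) (Set.Ioi 1) :=
        (integrableOn_Ioi_rpow_of_lt (by linarith) one_pos).const_mul C
      refine h1.congr_fun ?_ measurableSet_Ioi
      intro y hy
      have hy0 : (0 : ℝ) < y := lt_trans one_pos hy
      simp only [hf, smul_eq_mul]
      rw [min_eq_right (le_of_lt hy)]
      have : y ^ (-1 - s) = y ^ (n - 1) * y ^ (-((n : ℝ) + s)) := by
        rw [← Real.rpow_natCast, ← Real.rpow_add hy0, Nat.cast_sub hn]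
        congr 1; push_cast; ring
      rw [this]; ring
  refine lt_of_le_of_lt (lintegral_mono_ae ?_) hint.lintegral_lt_top
  have h0 : ∀ᵐ z : EuclideanSpace ℝ (Fin n), z ≠ 0 := by
    simp [ae_iff]
  filter_upwards [h0] with z hz
  rw [hf]
  simp only
  rw [ENNReal.ofReal_mul (by positivity)]
  exact mul_le_mul_right (hk z hz) _


/-! ### Interaction of two sets -/

/-- The interaction energy of two sets; the perimeter of `E` is the interaction of `E` and `Eᶜ`. -/
noncomputable def interaction {n : ℕ} (s : ℝ) (K A B : Set (EuclideanSpace ℝ (Fin n))) : ℝ≥0∞ :=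
  ∫⁻ x in A, ∫⁻ y in B, kernel s K (x - y)

theorem fracPerimeter_eq_interaction {n : ℕ} (s : ℝ) (K E : Set (EuclideanSpace ℝ (Fin n))) :
    fracPerimeter s K E = interaction s K E Eᶜ := rfl

theorem interaction_congr {n : ℕ} (s : ℝ) (K : Set (EuclideanSpace ℝ (Fin n)))
    {A A' B B' : Set (EuclideanSpace ℝ (Fin n))} (hA : A =ᵐ[volume] A') (hB : B =ᵐ[volume] B') :
    interaction s K A B = interaction s K A' B' := by
  rw [interaction, interaction, Measure.restrict_congr_set hA, Measure.restrict_congr_set hB]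

theorem fracPerimeter_congr {n : ℕ} (s : ℝ) (K : Set (EuclideanSpace ℝ (Fin n)))
    {E F : Set (EuclideanSpace ℝ (Fin n))} (h : E =ᵐ[volume] F) :
    fracPerimeter s K E = fracPerimeter s K F :=
  interaction_congr s K h h.compl

theorem measurable_kernel_sub {n : ℕ} (s : ℝ) {K : Set (EuclideanSpace ℝ (Fin n))}
    (hK : IsConvexBody K) (hKu : IsUnconditional K) :
    Measurable fun p : EuclideanSpace ℝ (Fin n) × EuclideanSpace ℝ (Fin n) =>
      kernel s K (p.1 - p.2) :=
  (measurable_kernel s hK hKu).comp (measurable_fst.sub measurable_snd)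

theorem interaction_eq_lintegral_indicator {n : ℕ} (s : ℝ) (K : Set (EuclideanSpace ℝ (Fin n)))
    {A B : Set (EuclideanSpace ℝ (Fin n))} (hA : MeasurableSet A) (hB : MeasurableSet B) :
    interaction s K A B =
      ∫⁻ x, ∫⁻ y, A.indicator 1 x * B.indicator 1 y * kernel s K (x - y) := by
  rw [interaction, ← lintegral_indicator hA]
  refine lintegral_congr fun x => ?_
  by_cases hx : x ∈ A
  · simp only [Set.indicator_of_mem hx, Pi.one_apply, one_mul]
    rw [← lintegral_indicator hB]
    refine lintegral_congr fun y => ?_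
    by_cases hy : y ∈ B <;> simp [hy]
  · simp [hx]

theorem interaction_union_right {n : ℕ} {s : ℝ} {K : Set (EuclideanSpace ℝ (Fin n))}
    (hK : IsConvexBody K) (hKu : IsUnconditional K) (A : Set (EuclideanSpace ℝ (Fin n)))
    {B C : Set (EuclideanSpace ℝ (Fin n))} (hC : MeasurableSet C)
    (hBC : Disjoint B C) :
    interaction s K A (B ∪ C) = interaction s K A B + interaction s K A C := by
  have hm := measurable_kernel_sub s hK hKu
  rw [interaction, interaction, interaction, ← lintegral_add_left]
  · simp_rw [lintegral_union hC hBC]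
  · exact hm.lintegral_prod_right'

theorem interaction_mono {n : ℕ} {s : ℝ} {K : Set (EuclideanSpace ℝ (Fin n))}
    {A A' B B' : Set (EuclideanSpace ℝ (Fin n))} (hA : A ⊆ A') (hB : B ⊆ B') :
    interaction s K A B ≤ interaction s K A' B' :=
  (lintegral_mono_set hA).trans (lintegral_mono fun _ => lintegral_mono_set hB)

theorem interaction_preimage {n : ℕ} (s : ℝ) (K : Set (EuclideanSpace ℝ (Fin n)))
    {A B : Set (EuclideanSpace ℝ (Fin n))}
    (φ : EuclideanSpace ℝ (Fin n) ≃ᵐ EuclideanSpace ℝ (Fin n))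
    (hφ : MeasurePreserving φ volume volume)
    (hk : ∀ x y, kernel s K (φ x - φ y) = kernel s K (x - y)) :
    interaction s K (φ ⁻¹' A) (φ ⁻¹' B) = interaction s K A B := by
  symm
  rw [interaction, interaction,
    ← hφ.setLIntegral_comp_preimage_emb φ.measurableEmbedding]
  refine lintegral_congr fun x => ?_
  rw [← hφ.setLIntegral_comp_preimage_emb φ.measurableEmbedding]
  simp_rw [hk]

theorem fracPerimeter_preimage_add {n : ℕ} (s : ℝ) (K E : Set (EuclideanSpace ℝ (Fin n)))
    (c : EuclideanSpace ℝ (Fin n)) :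
    fracPerimeter s K ((fun x => c + x) ⁻¹' E) = fracPerimeter s K E :=
  interaction_preimage s K (A := E) (B := Eᶜ) (MeasurableEquiv.addLeft c)
    (measurePreserving_add_left volume c) fun x y => by simp

theorem image_add_eq_preimage {n : ℕ} (c : EuclideanSpace ℝ (Fin n))
    (E : Set (EuclideanSpace ℝ (Fin n))) :
    (fun x => c + x) '' E = (fun x => -c + x) ⁻¹' E := by
  rw [Set.image_add_left]

/-- The pushforward of the restricted measure along a measurable embedding gives the change of
variables with no measurability of A or f. -/
theorem setLIntegral_smul {n : ℕ} {r : ℝ} (hr : 0 < r) (A : Set (EuclideanSpace ℝ (Fin n)))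
    (f : EuclideanSpace ℝ (Fin n) → ℝ≥0∞) :
    ∫⁻ x in r • A, f x = ENNReal.ofReal (r ^ n) * ∫⁻ x in A, f (r • x) := by
  have he : MeasurableEmbedding (fun x : EuclideanSpace ℝ (Fin n) => r • x) :=
    (Homeomorph.smulOfNeZero r hr.ne').measurableEmbedding
  have hpre : (fun x : EuclideanSpace ℝ (Fin n) => r • x) ⁻¹' (r • A) = A :=
    Set.preimage_image_eq A (smul_right_injective _ hr.ne')
  have hmap : (volume.restrict A).map (fun x : EuclideanSpace ℝ (Fin n) => r • x) =
      ENNReal.ofReal ((r ^ n)⁻¹) • volume.restrict (r • A) := by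
    have h1 := he.restrict_map volume (r • A)
    rw [hpre] at h1
    rw [← h1, Measure.map_addHaar_smul volume hr.ne', Measure.restrict_smul,
      finrank_euclideanSpace, Fintype.card_fin, abs_of_pos (by positivity)]
  rw [← he.lintegral_map, hmap, lintegral_smul_measure, smul_eq_mul, ← mul_assoc,
    ← ENNReal.ofReal_mul (by positivity), mul_inv_cancel₀ (by positivity), ENNReal.ofReal_one,
    one_mul]

/-- Each of the two integrals contributes r^n and the kernel r^(-(n+s)), whence the exponent n - s.
-/
theorem interaction_smul {n : ℕ} {s : ℝ} {K : Set (EuclideanSpace ℝ (Fin n))}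
    {r : ℝ} (hr : 0 < r) (A B : Set (EuclideanSpace ℝ (Fin n))) :
    interaction s K (r • A) (r • B) = ENNReal.ofReal (r ^ ((n : ℝ) - s)) * interaction s K A B := by
  have hk : ∀ x y : EuclideanSpace ℝ (Fin n), kernel s K (r • x - r • y) =
      ENNReal.ofReal (r ^ (-((n : ℝ) + s))) * kernel s K (x - y) := fun x y => by
    rw [← smul_sub, kernel_smul hr]
  rw [interaction, setLIntegral_smul hr]
  simp_rw [setLIntegral_smul hr, hk, lintegral_const_mul' _ _ ENNReal.ofReal_ne_top]
  rw [interaction, ← mul_assoc, ← mul_assoc, ← ENNReal.ofReal_mul (by positivity),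
    ← ENNReal.ofReal_mul (by positivity)]
  congr 2
  rw [← Real.rpow_natCast, ← Real.rpow_add hr, ← Real.rpow_add hr]
  congr 1; ring

theorem fracPerimeter_smul {n : ℕ} {s : ℝ} {K : Set (EuclideanSpace ℝ (Fin n))}
    {r : ℝ} (hr : 0 < r) (E : Set (EuclideanSpace ℝ (Fin n))) :
    fracPerimeter s K (r • E) = ENNReal.ofReal (r ^ ((n : ℝ) - s)) * fracPerimeter s K E := by
  have h : (r • E)ᶜ = r • Eᶜ :=
    (Set.image_compl_eq (Homeomorph.smulOfNeZero (α := EuclideanSpace ℝ (Fin n)) r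
      hr.ne').bijective).symm
  rw [fracPerimeter_eq_interaction, h, interaction_smul hr, fracPerimeter_eq_interaction]

/-! ### Polarization with respect to coordinate hyperplanes -/

theorem volume_hyperplane {n : ℕ} (i : Fin n) (a : ℝ) :
    volume {x : EuclideanSpace ℝ (Fin n) | x i = a} = 0 := by
  have h := (EuclideanSpace.volume_preserving_symm_measurableEquiv_toLp (Fin n))
  have h2 := Measure.pi_hyperplane (fun _ : Fin n => (volume : Measure ℝ)) i a
  rw [← volume_pi] at h2
  rw [← h2, ← h.measure_preimage_equiv]
  rfl

theorem ae_coord_ne {n : ℕ} (i : Fin n) (a : ℝ) :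
    ∀ᵐ x : EuclideanSpace ℝ (Fin n), x i ≠ a := by
  rw [ae_iff]
  simpa using volume_hyperplane i a

theorem measurable_coord {n : ℕ} (i : Fin n) :
    Measurable fun x : EuclideanSpace ℝ (Fin n) => x i := by fun_prop

/-- Off the null hyperplane x_i = 0 the complement of the half-space is its mirror image, and
reflection preserves volume. -/
theorem lintegral_eq_setLIntegral_add_reflection {n : ℕ} (i : Fin n)
    {f : EuclideanSpace ℝ (Fin n) → ℝ≥0∞} (hf : Measurable f) :
    ∫⁻ x, f x = ∫⁻ x in {x | x i < 0}, (f x + f (coordReflection i x)) := by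
  have hH : MeasurableSet {x : EuclideanSpace ℝ (Fin n) | x i < 0} :=
    measurableSet_lt (measurable_coord i) measurable_const
  rw [lintegral_add_left hf, ← lintegral_add_compl f hH]
  congr 1
  rw [(measurePreserving_coordReflection i).setLIntegral_comp_emb
    (reflIso i).toHomeomorph.measurableEmbedding]
  refine setLIntegral_congr ?_
  filter_upwards [ae_coord_ne i 0] with x hx
  apply propext
  change ¬ (x i < 0) ↔ x ∈ _ '' _
  constructor
  · intro h
    refine ⟨coordReflection i x, ?_, coordReflection_involutive i x⟩
    simp only [Set.mem_ofPred_eq, coordReflection_same]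
    have := lt_of_le_of_ne (not_lt.1 h) (Ne.symm hx)
    linarith
  · rintro ⟨y, hy, rfl⟩
    simp only [Set.mem_ofPred_eq] at hy
    simp only [coordReflection_same]
    linarith

/-- The polarization of `E` with respect to a coordinate hyperplane, favouring `{x | x i < 0}`. -/
def polarization {n : ℕ} (i : Fin n) (E : Set (EuclideanSpace ℝ (Fin n))) :
    Set (EuclideanSpace ℝ (Fin n)) :=
  {x | (x i < 0 ∧ (x ∈ E ∨ coordReflection i x ∈ E)) ∨
    (0 ≤ x i ∧ x ∈ E ∧ coordReflection i x ∈ E)}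

theorem measurableSet_polarization {n : ℕ} (i : Fin n) {E : Set (EuclideanSpace ℝ (Fin n))}
    (hE : MeasurableSet E) : MeasurableSet (polarization i E) := by
  have h1 : MeasurableSet {x : EuclideanSpace ℝ (Fin n) | x i < 0} :=
    measurableSet_lt (measurable_coord i) measurable_const
  have h2 : MeasurableSet {x : EuclideanSpace ℝ (Fin n) | 0 ≤ x i} :=
    measurableSet_le measurable_const (measurable_coord i)
  have h3 : MeasurableSet (coordReflection i ⁻¹' E) :=
    (measurePreserving_coordReflection i).measurable hE
  exact (h1.inter (hE.union h3)).union (h2.inter (hE.inter h3))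

theorem mem_polarization_of_neg {n : ℕ} {i : Fin n} {E : Set (EuclideanSpace ℝ (Fin n))}
    {x : EuclideanSpace ℝ (Fin n)} (hx : x i < 0) :
    x ∈ polarization i E ↔ x ∈ E ∨ coordReflection i x ∈ E := by
  simp [polarization, hx, not_le.2 hx]

theorem coordReflection_mem_polarization_of_neg {n : ℕ} {i : Fin n}
    {E : Set (EuclideanSpace ℝ (Fin n))} {x : EuclideanSpace ℝ (Fin n)} (hx : x i < 0) :
    coordReflection i x ∈ polarization i E ↔ x ∈ E ∧ coordReflection i x ∈ E := by
  have h1 : 0 ≤ -x i := by linarith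
  have h2 : ¬ (-x i < 0) := by linarith
  simp [polarization, hx.le, not_lt.2 hx.le, and_comm]

theorem isBounded_polarization {n : ℕ} (i : Fin n) {E : Set (EuclideanSpace ℝ (Fin n))}
    (hE : Bornology.IsBounded E) : Bornology.IsBounded (polarization i E) := by
  obtain ⟨R, hR⟩ := hE.subset_closedBall 0
  refine (Metric.isBounded_closedBall (x := (0 : EuclideanSpace ℝ (Fin n))) (r := R)).subset ?_
  rintro x (⟨-, h | h⟩ | ⟨-, h, -⟩)
  · exact hR h
  · have := hR h
    rw [mem_closedBall_zero_iff, norm_coordReflection] at this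
    rwa [mem_closedBall_zero_iff]
  · exact hR h

theorem volume_polarization {n : ℕ} (i : Fin n) {E : Set (EuclideanSpace ℝ (Fin n))}
    (hE : MeasurableSet E) : volume (polarization i E) = volume E := by
  have hH : MeasurableSet {x : EuclideanSpace ℝ (Fin n) | x i < 0} :=
    measurableSet_lt (measurable_coord i) measurable_const
  rw [← lintegral_indicator_one hE, ← lintegral_indicator_one (measurableSet_polarization i hE),
    lintegral_eq_setLIntegral_add_reflection i (measurable_one.indicator hE),
    lintegral_eq_setLIntegral_add_reflection i
      (measurable_one.indicator (measurableSet_polarization i hE))]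
  refine setLIntegral_congr_fun hH fun x hx => ?_
  have h1 := mem_polarization_of_neg (E := E) hx
  have h2 := coordReflection_mem_polarization_of_neg (E := E) hx
  by_cases ha : x ∈ E <;> by_cases hb : coordReflection i x ∈ E <;>
    simp [Set.indicator, ha, hb, h1, h2]

/-- A pair in the half-space stands for four pairs of points. Reflection invariance leaves only two
kernel values among them, one for points on the same side and one for points on opposite sides, so
perimeters can be compared pair by pair. -/
theorem fracPerimeter_eq_folded {n : ℕ} {s : ℝ} {K : Set (EuclideanSpace ℝ (Fin n))}
    (hK : IsConvexBody K) (hKu : IsUnconditional K) (i : Fin n)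
    {E : Set (EuclideanSpace ℝ (Fin n))} (hE : MeasurableSet E) :
    fracPerimeter s K E = ∫⁻ x in {x | x i < 0}, ∫⁻ y in {x | x i < 0},
      ((E.indicator 1 x * Eᶜ.indicator 1 y +
          E.indicator 1 (coordReflection i x) * Eᶜ.indicator 1 (coordReflection i y)) *
          kernel s K (x - y) +
        (E.indicator 1 x * Eᶜ.indicator 1 (coordReflection i y) +
          E.indicator 1 (coordReflection i x) * Eᶜ.indicator 1 y) *
          kernel s K (x - coordReflection i y)) := by
  rw [fracPerimeter_eq_interaction, interaction_eq_lintegral_indicator s K hE hE.compl]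
  have hk := measurable_kernel_sub s hK hKu
  have he : Measurable (E.indicator (1 : EuclideanSpace ℝ (Fin n) → ℝ≥0∞)) :=
    measurable_one.indicator hE
  have he' : Measurable (Eᶜ.indicator (1 : EuclideanSpace ℝ (Fin n) → ℝ≥0∞)) :=
    measurable_one.indicator hE.compl
  have hσ : Measurable (coordReflection i (n := n)) :=
    (measurePreserving_coordReflection i).measurable
  have hg : Measurable fun p : EuclideanSpace ℝ (Fin n) × EuclideanSpace ℝ (Fin n) =>
      E.indicator 1 p.1 * Eᶜ.indicator 1 p.2 * kernel s K (p.1 - p.2) :=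
    ((he.comp measurable_fst).mul (he'.comp measurable_snd)).mul hk
  rw [lintegral_eq_setLIntegral_add_reflection i hg.lintegral_prod_right']
  refine lintegral_congr fun x => ?_
  have hgx : ∀ x, Measurable fun y =>
      E.indicator 1 x * Eᶜ.indicator 1 y * kernel s K (x - y) := fun x =>
    hg.comp measurable_prodMk_left
  simp only
  rw [lintegral_eq_setLIntegral_add_reflection i (hgx x),
    lintegral_eq_setLIntegral_add_reflection i (hgx (coordReflection i x)),
    ← lintegral_add_left (f := fun y => E.indicator 1 x * Eᶜ.indicator 1 y * kernel s K (x - y) +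
      E.indicator 1 x * Eᶜ.indicator 1 (coordReflection i y) * kernel s K (x - coordReflection i y))
      ((hgx x).add ((hgx x).comp hσ))]
  refine lintegral_congr fun y => ?_
  have h1 : kernel s K (coordReflection i x - coordReflection i y) = kernel s K (x - y) := by
    rw [← coordReflection_sub, kernel_coordReflection s hKu]
  have h2 : kernel s K (coordReflection i x - y) = kernel s K (x - coordReflection i y) := by
    rw [← kernel_coordReflection s hKu i, coordReflection_sub, coordReflection_involutive]
  rw [h1, h2]
  ring

/-- For x_i and y_i both negative, |x_i - y_i| < |x_i + y_i|, while the other coordinates of the two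
differences agree. -/
theorem kernel_sub_reflection_lt {n : ℕ} {s : ℝ} (hs : 0 < s)
    {K : Set (EuclideanSpace ℝ (Fin n))} (hK : IsConvexBody K) (hKu : IsUnconditional K)
    (hKs : StrictConvex ℝ K) {i : Fin n} {x y : EuclideanSpace ℝ (Fin n)} (hx : x i < 0)
    (hy : y i < 0) (hxy : x ≠ y) :
    kernel s K (x - coordReflection i y) < kernel s K (x - y) := by
  refine kernel_lt_kernel hs hK hKu hKs i (sub_ne_zero.2 hxy) (fun j hj => ?_) ?_
  · simp [coordReflection_apply, hj]
  · simp only [PiLp.sub_apply, coordReflection_same]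
    rw [abs_lt, abs_of_neg (by linarith : x i - -y i < 0)]
    constructor <;> linarith

/-- The part of `E` in `{x | x i < 0}` whose reflection avoids `E`. -/
def excess {n : ℕ} (i : Fin n) (E : Set (EuclideanSpace ℝ (Fin n))) :
    Set (EuclideanSpace ℝ (Fin n)) :=
  {x | x i < 0 ∧ x ∈ E ∧ coordReflection i x ∉ E}

theorem mem_excess {n : ℕ} {i : Fin n} {E : Set (EuclideanSpace ℝ (Fin n))}
    {x : EuclideanSpace ℝ (Fin n)} :
    x ∈ excess i E ↔ x i < 0 ∧ x ∈ E ∧ coordReflection i x ∉ E := Iff.rfl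

theorem measurableSet_excess {n : ℕ} (i : Fin n) {E : Set (EuclideanSpace ℝ (Fin n))}
    (hE : MeasurableSet E) : MeasurableSet (excess i E) :=
  (measurableSet_lt (measurable_coord i) measurable_const).inter
    (hE.inter ((measurePreserving_coordReflection i).measurable hE).compl)

theorem measurable_kernel_sub_reflection {n : ℕ} (s : ℝ) {K : Set (EuclideanSpace ℝ (Fin n))}
    (hK : IsConvexBody K) (hKu : IsUnconditional K) (i : Fin n) :
    Measurable fun p : EuclideanSpace ℝ (Fin n) × EuclideanSpace ℝ (Fin n) =>
      kernel s K (p.1 - p.2) - kernel s K (p.1 - coordReflection i p.2) := by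
  have hσ := (measurePreserving_coordReflection i).measurable
  have hk := measurable_kernel s hK hKu
  have h1 : Measurable fun p : EuclideanSpace ℝ (Fin n) × EuclideanSpace ℝ (Fin n) =>
      p.1 - coordReflection i p.2 := measurable_fst.sub (hσ.comp measurable_snd)
  have h2 : Measurable fun p : EuclideanSpace ℝ (Fin n) × EuclideanSpace ℝ (Fin n) =>
      kernel s K (p.1 - coordReflection i p.2) := hk.comp h1
  exact (measurable_kernel_sub s hK hKu).sub h2

theorem measurable_kernel_sub_reflection_right {n : ℕ} (s : ℝ)
    {K : Set (EuclideanSpace ℝ (Fin n))} (hK : IsConvexBody K) (hKu : IsUnconditional K)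
    (i : Fin n) (x : EuclideanSpace ℝ (Fin n)) :
    Measurable fun y => kernel s K (x - y) - kernel s K (x - coordReflection i y) := by
  have hσ := (measurePreserving_coordReflection i).measurable
  have hk := measurable_kernel s hK hKu
  have h1 : Measurable fun y => x - coordReflection i y := hσ.const_sub x
  have h2 : Measurable fun y => kernel s K (x - coordReflection i y) := hk.comp h1
  have h3 : Measurable fun y => kernel s K (x - y) := hk.comp (measurable_id.const_sub x)
  exact h3.sub h2

theorem setLIntegral_excess_eq {n : ℕ} (i : Fin n)
    {A B : Set (EuclideanSpace ℝ (Fin n))} (hA : MeasurableSet A) (hB : MeasurableSet B)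
    (hAH : A ⊆ {x | x i < 0}) (hBH : B ⊆ {x | x i < 0})
    (g : EuclideanSpace ℝ (Fin n) → EuclideanSpace ℝ (Fin n) → ℝ≥0∞) :
    ∫⁻ x in A, ∫⁻ y in B, g x y =
      ∫⁻ x in {x | x i < 0}, ∫⁻ y in {x | x i < 0},
        A.indicator 1 x * (B.indicator 1 y * g x y) := by
  rw [← Set.inter_eq_left.2 hAH, ← Set.inter_eq_left.2 hBH, ← setLIntegral_indicator hA]
  refine lintegral_congr fun x => ?_
  rw [Set.inter_eq_left.2 hAH]
  by_cases hx : x ∈ A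
  · simp only [Set.indicator_of_mem hx, Pi.one_apply, one_mul]
    rw [← setLIntegral_indicator hB, Set.inter_eq_left.2 hBH]
    refine lintegral_congr fun y => ?_
    by_cases hy : y ∈ B <;> simp [hy]
  · simp [hx]

/-- The polarization inequality with the gain for the non-comparable parts. -/
theorem fracPerimeter_polarization_add_le {n : ℕ} {s : ℝ} (hs : 0 < s)
    {K : Set (EuclideanSpace ℝ (Fin n))}
    (hK : IsConvexBody K) (hKu : IsUnconditional K) (hKs : StrictConvex ℝ K) (i : Fin n)
    {E : Set (EuclideanSpace ℝ (Fin n))} (hE : MeasurableSet E) :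
    fracPerimeter s K (polarization i E) +
      ∫⁻ x in excess i E, ∫⁻ y in excess i Eᶜ,
          (kernel s K (x - y) - kernel s K (x - coordReflection i y)) ≤ fracPerimeter s K E := by
  have : Nonempty (Fin n) := ⟨i⟩
  have hH : MeasurableSet {x : EuclideanSpace ℝ (Fin n) | x i < 0} :=
    measurableSet_lt (measurable_coord i) measurable_const
  have hA := measurableSet_excess i hE
  have hB := measurableSet_excess i hE.compl
  have hm : Measurable fun p : EuclideanSpace ℝ (Fin n) × EuclideanSpace ℝ (Fin n) =>
      (excess i E).indicator 1 p.1 * ((excess i Eᶜ).indicator 1 p.2 *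
        (kernel s K (p.1 - p.2) - kernel s K (p.1 - coordReflection i p.2))) :=
    ((measurable_one.indicator hA).comp measurable_fst).mul
      (((measurable_one.indicator hB).comp measurable_snd).mul
        (measurable_kernel_sub_reflection s hK hKu i))
  rw [setLIntegral_excess_eq i hA hB (fun x hx => hx.1) (fun x hx => hx.1),
    fracPerimeter_eq_folded hK hKu i hE,
    fracPerimeter_eq_folded hK hKu i (measurableSet_polarization i hE),
    ← lintegral_add_right _ hm.lintegral_prod_right']
  refine setLIntegral_mono' hH fun x hx => ?_
  have hmx : Measurable fun y => (excess i E).indicator 1 x * ((excess i Eᶜ).indicator 1 y *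
      (kernel s K (x - y) - kernel s K (x - coordReflection i y))) :=
    hm.comp measurable_prodMk_left
  rw [← lintegral_add_right _ hmx]
  -- The diagonal must be discarded: there the kernel has the default value 0, and the comparison of
  -- kernels fails.
  have hne : ∀ᵐ y : EuclideanSpace ℝ (Fin n), y ≠ x := by simp [ae_iff]
  refine setLIntegral_mono_ae' hH ?_
  filter_upwards [hne] with y hyx hy
  have hlt := (kernel_sub_reflection_lt hs hK hKu hKs hx hy hyx.symm).le
  have h1 := mem_polarization_of_neg (E := E) hx
  have h2 := coordReflection_mem_polarization_of_neg (E := E) hx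
  have h3 := mem_polarization_of_neg (E := E) hy
  have h4 := coordReflection_mem_polarization_of_neg (E := E) hy
  have hxA : x ∈ excess i E ↔ x ∈ E ∧ coordReflection i x ∉ E := and_iff_right hx
  have hyB : y ∈ excess i Eᶜ ↔ y ∉ E ∧ coordReflection i y ∈ E := by
    rw [mem_excess, and_iff_right (show y i < 0 from hy), Set.mem_compl_iff, Set.mem_compl_iff,
      not_not]
  -- Sixteen membership patterns. The integrand changes only if one of x, y lies in `excess i E` and
  -- the other in `excess i Eᶜ`; then the same-side kernel is replaced by the opposite-side one. The
  -- gain is recorded only for x in the former and y in the latter, the mirrored case being bounded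
  -- by monotonicity.
  by_cases ha : x ∈ E <;> by_cases hb : coordReflection i x ∈ E <;>
    by_cases hc : y ∈ E <;> by_cases hd : coordReflection i y ∈ E <;>
    simp only [ha, hb, hc, hd, or_true, or_false, and_true, and_false,
      not_true, not_false_iff, iff_true, iff_false] at h1 h2 h3 h4 hxA hyB <;>
    simp [Set.indicator, ha, hb, hc, hd, h1, h2, h3, h4, hxA, hyB, hlt]

theorem setLIntegral_excess_pos {n : ℕ} {s : ℝ} (hs : 0 < s)
    {K : Set (EuclideanSpace ℝ (Fin n))}
    (hK : IsConvexBody K) (hKu : IsUnconditional K) (hKs : StrictConvex ℝ K) (i : Fin n)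
    {B : Set (EuclideanSpace ℝ (Fin n))} (hB : MeasurableSet B) (hBH : B ⊆ {x | x i < 0})
    (hB0 : volume B ≠ 0) {x : EuclideanSpace ℝ (Fin n)} (hx : x i < 0) :
    ∫⁻ y in B, (kernel s K (x - y) - kernel s K (x - coordReflection i y)) ≠ 0 := by
  intro h
  have : Nonempty (Fin n) := ⟨i⟩
  rw [lintegral_eq_zero_iff (measurable_kernel_sub_reflection_right s hK hKu i x),
    Filter.EventuallyEq, ae_restrict_iff' hB] at h
  apply hB0
  rw [measure_eq_zero_iff_ae_notMem]
  have hne : ∀ᵐ y : EuclideanSpace ℝ (Fin n), y ≠ x := by simp [ae_iff]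
  filter_upwards [h, hne] with y hy hyx hyB
  have h' := hy hyB
  rw [Pi.zero_apply, tsub_eq_zero_iff_le] at h'
  exact absurd h' (not_le.2 (kernel_sub_reflection_lt hs hK hKu hKs hx (hBH hyB) hyx.symm))

/-- A set of finite perimeter whose polarization does not decrease the perimeter is comparable to
its reflection in one of the half-spaces. -/
theorem reflection_comparable_of_le_polarization {n : ℕ} {s : ℝ} (hs : 0 < s)
    {K : Set (EuclideanSpace ℝ (Fin n))}
    (hK : IsConvexBody K) (hKu : IsUnconditional K) (hKs : StrictConvex ℝ K) (i : Fin n)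
    {E : Set (EuclideanSpace ℝ (Fin n))} (hE : MeasurableSet E)
    (hfin : fracPerimeter s K E ≠ ∞)
    (hle : fracPerimeter s K E ≤ fracPerimeter s K (polarization i E)) :
    (∀ᵐ x : EuclideanSpace ℝ (Fin n), x i < 0 → x ∈ E → coordReflection i x ∈ E) ∨
      (∀ᵐ x : EuclideanSpace ℝ (Fin n), x i < 0 → coordReflection i x ∈ E → x ∈ E) := by
  have : Nonempty (Fin n) := ⟨i⟩
  have hmain := fracPerimeter_polarization_add_le hs hK hKu hKs i hE
  have hk' := measurable_kernel_sub_reflection s hK hKu i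
  -- Finite perimeter allows cancellation, so the gain vanishes. Its integrand is positive almost
  -- everywhere on the product of the two excess sets, so one of them is null.
  have hzero : ∫⁻ x in excess i E, ∫⁻ y in excess i Eᶜ,
      (kernel s K (x - y) - kernel s K (x - coordReflection i y)) = 0 := by
    refine le_antisymm ((ENNReal.add_le_add_iff_left hfin).1 ?_) bot_le
    rw [add_zero]
    exact le_trans (by gcongr) hmain
  rw [lintegral_eq_zero_iff hk'.lintegral_prod_right'] at hzero
  by_cases hB0 : volume (excess i Eᶜ) = 0
  · right
    rw [measure_eq_zero_iff_ae_notMem] at hB0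
    filter_upwards [hB0] with x hx h1 h2
    by_contra h3
    exact hx (mem_excess.2 ⟨h1, h3, fun h => h h2⟩)
  · left
    have h0 : ∀ᵐ x ∂(volume.restrict (excess i E)), x ∉ excess i E := by
      filter_upwards [hzero] with x hx hxA
      exact setLIntegral_excess_pos hs hK hKu hKs i (measurableSet_excess i hE.compl)
        (fun y hy => hy.1) hB0 hxA.1 hx
    rw [ae_restrict_iff' (measurableSet_excess i hE)] at h0
    filter_upwards [h0] with x hx h1 h2
    by_contra h3
    exact hx ⟨h1, h2, h3⟩ ⟨h1, h2, h3⟩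


/-! ### Finiteness of the perimeter of balls -/

/-- Substitute z = x - y and apply Tonelli. This reduces finiteness of a perimeter to the volume
that a translation by z moves out of the set. -/
theorem interaction_eq_lintegral_kernel_mul {n : ℕ} (s : ℝ) {K : Set (EuclideanSpace ℝ (Fin n))}
    (hK : IsConvexBody K) (hKu : IsUnconditional K)
    {A B : Set (EuclideanSpace ℝ (Fin n))} (hA : MeasurableSet A) (hB : MeasurableSet B) :
    interaction s K A B = ∫⁻ z, volume {x | x ∈ A ∧ x - z ∈ B} * kernel s K z := by
  rw [interaction_eq_lintegral_indicator s K hA hB]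
  have h1 : ∀ x, ∫⁻ y, A.indicator 1 x * B.indicator 1 y * kernel s K (x - y) =
      ∫⁻ z, A.indicator 1 x * B.indicator 1 (x - z) * kernel s K z := fun x => by
    rw [← lintegral_sub_left_eq_self _ x]
    simp
  simp_rw [h1]
  have hk := measurable_kernel s hK hKu
  have hmA : Measurable (A.indicator (1 : EuclideanSpace ℝ (Fin n) → ℝ≥0∞)) :=
    measurable_one.indicator hA
  have hmB : Measurable (B.indicator (1 : EuclideanSpace ℝ (Fin n) → ℝ≥0∞)) :=
    measurable_one.indicator hB
  have hsub : Measurable fun p : EuclideanSpace ℝ (Fin n) × EuclideanSpace ℝ (Fin n) =>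
      p.1 - p.2 := measurable_fst.sub measurable_snd
  have hm : Measurable fun p : EuclideanSpace ℝ (Fin n) × EuclideanSpace ℝ (Fin n) =>
      A.indicator 1 p.1 * B.indicator 1 (p.1 - p.2) * kernel s K p.2 :=
    ((hmA.comp measurable_fst).mul (hmB.comp hsub)).mul (hk.comp measurable_snd)
  rw [lintegral_lintegral_swap hm.aemeasurable]
  refine lintegral_congr fun z => ?_
  rw [lintegral_mul_const' _ _ (kernel_lt_top z).ne]
  congr 1
  have hmz : Measurable fun x : EuclideanSpace ℝ (Fin n) => x - z := measurable_id.sub_const z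
  have hmeas : MeasurableSet {x | x ∈ A ∧ x - z ∈ B} := hA.inter (hmz hB)
  rw [← lintegral_indicator_one hmeas]
  refine lintegral_congr fun x => ?_
  by_cases hx : x ∈ A <;> by_cases hy : x - z ∈ B <;> simp [Set.indicator, hx, hy]

/-- For ‖z‖ ≤ 1 the points leaving the ball lie in the shell 1 - ‖z‖ < ‖x‖ ≤ 1, and Bernoulli's
inequality bounds 1 - (1 - ‖z‖)^n by n‖z‖; for larger z the volume of the ball suffices. -/
theorem volume_closedBall_diff_translate_le {n : ℕ} (hn : 1 ≤ n) (z : EuclideanSpace ℝ (Fin n)) :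
    volume {x : EuclideanSpace ℝ (Fin n) |
      x ∈ Metric.closedBall 0 1 ∧ x - z ∈ (Metric.closedBall (0 : EuclideanSpace ℝ (Fin n)) 1)ᶜ} ≤
    (n * volume (Metric.ball (0 : EuclideanSpace ℝ (Fin n)) 1)) * ENNReal.ofReal (min ‖z‖ 1) := by
  have : Nonempty (Fin n) := ⟨⟨0, hn⟩⟩
  set ω := volume (Metric.ball (0 : EuclideanSpace ℝ (Fin n)) 1)
  have hball : ∀ r : ℝ, 0 ≤ r → volume (Metric.closedBall (0 : EuclideanSpace ℝ (Fin n)) r) =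
      ENNReal.ofReal (r ^ n) * ω := fun r hr => by
    rw [Measure.addHaar_closedBall _ _ hr, finrank_euclideanSpace, Fintype.card_fin]
  have hω : ω ≠ ∞ := measure_ball_lt_top.ne
  rcases le_total 1 ‖z‖ with h | h
  · rw [min_eq_right h, ENNReal.ofReal_one, mul_one]
    refine (measure_mono (t := Metric.closedBall 0 1) fun x hx => hx.1).trans ?_
    rw [hball 1 zero_le_one, one_pow, ENNReal.ofReal_one]
    gcongr
    exact_mod_cast hn
  · rw [min_eq_left h]
    have hsub : {x : EuclideanSpace ℝ (Fin n) | x ∈ Metric.closedBall 0 1 ∧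
        x - z ∈ (Metric.closedBall (0 : EuclideanSpace ℝ (Fin n)) 1)ᶜ} ⊆
        Metric.closedBall 0 1 \ Metric.closedBall 0 (1 - ‖z‖) := by
      rintro x ⟨h1, h2⟩
      refine ⟨h1, fun h3 => h2 ?_⟩
      rw [mem_closedBall_zero_iff] at h3 ⊢
      linarith [norm_sub_le x z]
    refine (measure_mono hsub).trans ?_
    rw [measure_sdiff (Metric.closedBall_subset_closedBall (by linarith [norm_nonneg z]))
      measurableSet_closedBall.nullMeasurableSet measure_closedBall_lt_top.ne,
      hball 1 zero_le_one, hball _ (by linarith), ← ENNReal.sub_mul (fun _ _ => hω),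
      ← ENNReal.ofReal_sub _ (by have := sub_nonneg.2 h; positivity), mul_right_comm]
    gcongr
    rw [← ENNReal.ofReal_natCast, ← ENNReal.ofReal_mul (by positivity)]
    refine ENNReal.ofReal_le_ofReal ?_
    have := one_add_mul_le_pow (show (-2 : ℝ) ≤ -‖z‖ by linarith) n
    rw [one_pow, sub_eq_add_neg 1 ‖z‖]
    linarith

theorem fracPerimeter_closedBall_lt_top {n : ℕ} (hn : 1 ≤ n) {s : ℝ} (hs0 : 0 < s)
    (hs1 : s < 1) {K : Set (EuclideanSpace ℝ (Fin n))}
    (hK : IsConvexBody K) (hKu : IsUnconditional K) :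
    fracPerimeter s K (Metric.closedBall 0 1) < ∞ := by
  rw [fracPerimeter_eq_interaction, interaction_eq_lintegral_kernel_mul s hK hKu
    measurableSet_closedBall measurableSet_closedBall.compl]
  have hω : (n : ℝ≥0∞) * volume (Metric.ball (0 : EuclideanSpace ℝ (Fin n)) 1) ≠ ∞ :=
    ENNReal.mul_ne_top (ENNReal.natCast_ne_top n) measure_ball_lt_top.ne
  refine lt_of_le_of_lt (lintegral_mono fun z =>
    mul_le_mul_left (volume_closedBall_diff_translate_le hn z) _) ?_
  simp_rw [mul_assoc _ (ENNReal.ofReal _)]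
  rw [lintegral_const_mul' _ _ hω]
  exact ENNReal.mul_lt_top hω.lt_top (lintegral_min_norm_mul_kernel_lt_top hn hs0 hs1 hK hKu)

theorem isoConst_lt_top {n : ℕ} (hn : 1 ≤ n) {s : ℝ} (hs0 : 0 < s)
    (hs1 : s < 1) {K : Set (EuclideanSpace ℝ (Fin n))}
    (hK : IsConvexBody K) (hKu : IsUnconditional K) : isoConst s K < ∞ := by
  have hpos : 0 < volume (Metric.closedBall (0 : EuclideanSpace ℝ (Fin n)) 1) :=
    Metric.measure_closedBall_pos _ _ one_pos
  refine lt_of_le_of_lt (sInf_le ⟨Metric.closedBall 0 1, measurableSet_closedBall,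
    Metric.isBounded_closedBall, hpos, rfl⟩) ?_
  refine ENNReal.div_lt_top (fracPerimeter_closedBall_lt_top hn hs0 hs1 hK hKu).ne ?_
  exact (ENNReal.rpow_pos hpos measure_closedBall_lt_top.ne).ne'

theorem exponent_pos {n : ℕ} (hn : 1 ≤ n) {s : ℝ} (hs1 : s < 1) : 0 < ((n : ℝ) - s) / n := by
  have : (1 : ℝ) ≤ n := by exact_mod_cast hn
  exact div_pos (by linarith) (by linarith)

theorem isoConst_mul_le_of_isBounded {n : ℕ} (hn : 1 ≤ n) {s : ℝ} (hs1 : s < 1)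
    (K : Set (EuclideanSpace ℝ (Fin n))) {E : Set (EuclideanSpace ℝ (Fin n))}
    (hE : MeasurableSet E) (hEb : Bornology.IsBounded E) :
    isoConst s K * volume E ^ (((n : ℝ) - s) / n) ≤ fracPerimeter s K E := by
  rcases eq_or_ne (volume E) 0 with h0 | h0
  · rw [h0, ENNReal.zero_rpow_of_pos (exponent_pos hn hs1), mul_zero]
    exact bot_le
  · have hpos : 0 < volume E := pos_iff_ne_zero.2 h0
    have h1 : isoConst s K ≤ fracPerimeter s K E / volume E ^ (((n : ℝ) - s) / n) :=
      sInf_le ⟨E, hE, hEb, hpos, rfl⟩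
    exact (ENNReal.le_div_iff_mul_le
      (Or.inl (ENNReal.rpow_pos hpos hEb.measure_lt_top.ne).ne')
      (Or.inl (ENNReal.rpow_ne_top_of_nonneg (exponent_pos hn hs1).le
        hEb.measure_lt_top.ne))).1 h1

/-! ### The isoperimetric inequality for sets of finite measure -/

/-- Truncation creates only one new interaction, that between the two pieces of E. -/
theorem fracPerimeter_inter_le {n : ℕ} {s : ℝ} {K : Set (EuclideanSpace ℝ (Fin n))}
    (hK : IsConvexBody K) (hKu : IsUnconditional K) {E B : Set (EuclideanSpace ℝ (Fin n))}
    (hE : MeasurableSet E) (hB : MeasurableSet B) :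
    fracPerimeter s K (E ∩ B) ≤ fracPerimeter s K E + interaction s K (E ∩ B) (E \ B) := by
  have h : (E ∩ B)ᶜ = Eᶜ ∪ E \ B := by
    ext x; by_cases hx : x ∈ E <;> simp [hx]
  have hd : Disjoint Eᶜ (E \ B) := Set.disjoint_left.2 fun x hx hx' => absurd hx'.1 hx
  rw [fracPerimeter_eq_interaction, h, interaction_union_right hK hKu _ (hE.diff hB) hd]
  gcongr
  exact interaction_mono Set.inter_subset_left le_rfl

/-- By Tonelli, a pair x, y is charged for the radii in [T, T+1] with ‖x‖ ≤ R < ‖y‖. These have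
length at most min(‖x - y‖, 1), and there are none unless y lies outside the ball of radius T. -/
theorem lintegral_interaction_closedBall_le {n : ℕ} {s : ℝ} {K : Set (EuclideanSpace ℝ (Fin n))}
    (hK : IsConvexBody K) (hKu : IsUnconditional K) {E : Set (EuclideanSpace ℝ (Fin n))}
    (hE : MeasurableSet E) (T : ℝ) :
    ∫⁻ R in Set.Icc T (T + 1),
      interaction s K (E ∩ Metric.closedBall 0 R) (E \ Metric.closedBall 0 R) ≤
    (∫⁻ z, ENNReal.ofReal (min ‖z‖ 1) * kernel s K z) *
      volume (E \ Metric.closedBall 0 T) := by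
  set S : Set (ℝ × EuclideanSpace ℝ (Fin n) × EuclideanSpace ℝ (Fin n)) :=
    {p | p.2.1 ∈ E ∧ p.2.2 ∈ E ∧ ‖p.2.1‖ ≤ p.1 ∧ p.1 < ‖p.2.2‖} with hSdef
  have hS : MeasurableSet S := by
    have h1 : Measurable fun p : ℝ × EuclideanSpace ℝ (Fin n) × EuclideanSpace ℝ (Fin n) =>
      p.2.1 := by fun_prop
    have h2 : Measurable fun p : ℝ × EuclideanSpace ℝ (Fin n) × EuclideanSpace ℝ (Fin n) =>
      p.2.2 := by fun_prop
    exact (h1 hE).inter ((h2 hE).inter ((measurableSet_le h1.norm measurable_fst).inter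
      (measurableSet_lt measurable_fst h2.norm)))
  have hk := measurable_kernel s hK hKu
  have hkp : Measurable fun p : EuclideanSpace ℝ (Fin n) × EuclideanSpace ℝ (Fin n) =>
      kernel s K (p.1 - p.2) := measurable_kernel_sub s hK hKu
  have hm : Measurable fun p : ℝ × EuclideanSpace ℝ (Fin n) × EuclideanSpace ℝ (Fin n) =>
      S.indicator 1 p * kernel s K (p.2.1 - p.2.2) :=
    (measurable_one.indicator hS).mul (hkp.comp measurable_snd)
  have hI : ∀ R : ℝ, interaction s K (E ∩ Metric.closedBall 0 R) (E \ Metric.closedBall 0 R) =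
      ∫⁻ p : EuclideanSpace ℝ (Fin n) × EuclideanSpace ℝ (Fin n),
        S.indicator 1 (R, p) * kernel s K (p.1 - p.2) ∂(volume.prod volume) := by
    intro R
    rw [interaction_eq_lintegral_indicator s K (hE.inter measurableSet_closedBall)
      (hE.diff measurableSet_closedBall), lintegral_prod]
    · refine lintegral_congr fun x => lintegral_congr fun y => ?_
      by_cases h1 : x ∈ E <;> by_cases h2 : y ∈ E <;> by_cases h3 : ‖x‖ ≤ R <;>
        by_cases h4 : R < ‖y‖ <;> simp [Set.indicator, hSdef, h1, h2, h3, h4]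
    · exact (hm.comp measurable_prodMk_left).aemeasurable
  simp_rw [hI]
  rw [lintegral_lintegral_swap hm.aemeasurable]
  have hinner : ∀ p : EuclideanSpace ℝ (Fin n) × EuclideanSpace ℝ (Fin n),
      ∫⁻ R in Set.Icc T (T + 1), S.indicator 1 (R, p) * kernel s K (p.1 - p.2) ≤
      (E \ Metric.closedBall 0 T).indicator 1 p.2 *
        (ENNReal.ofReal (min ‖p.1 - p.2‖ 1) * kernel s K (p.1 - p.2)) := by
    intro p
    rw [lintegral_mul_const' _ _ (kernel_lt_top _).ne, ← mul_assoc]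
    gcongr
    by_cases hp : p.2 ∈ E \ Metric.closedBall 0 T
    · rw [Set.indicator_of_mem hp, Pi.one_apply, one_mul]
      have hle : ∀ R : ℝ, (S.indicator 1 (R, p) : ℝ≥0∞) ≤
          (Set.Ico ‖p.1‖ ‖p.2‖).indicator 1 R := by
        intro R
        by_cases hR : (R, p) ∈ S
        · have hR' : R ∈ Set.Ico ‖p.1‖ ‖p.2‖ := hR.2.2
          simp [hR, hR']
        · simp [hR]
      refine (lintegral_mono hle).trans ?_
      rw [lintegral_indicator_one measurableSet_Ico, Measure.restrict_apply measurableSet_Ico]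
      rcases le_total ‖p.1 - p.2‖ 1 with h | h
      · rw [min_eq_left h]
        refine (measure_mono Set.inter_subset_left).trans ?_
        rw [Real.volume_Ico]
        refine ENNReal.ofReal_le_ofReal ?_
        rw [norm_sub_rev]
        exact norm_sub_norm_le _ _
      · rw [min_eq_right h]
        refine (measure_mono Set.inter_subset_right).trans ?_
        rw [Real.volume_Icc]
        simp
    · have h0 : ∀ R ∈ Set.Icc T (T + 1), (S.indicator 1 (R, p) : ℝ≥0∞) = 0 := by
        intro R hR
        refine Set.indicator_of_notMem ?_ _
        rintro ⟨-, h2, -, h4⟩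
        refine hp ⟨h2, fun h => ?_⟩
        rw [mem_closedBall_zero_iff] at h
        have : R < ‖p.2‖ := h4
        linarith [hR.1]
      rw [setLIntegral_congr_fun measurableSet_Icc h0]
      simp
  refine (lintegral_mono hinner).trans ?_
  have hcb : MeasurableSet (E \ Metric.closedBall (0 : EuclideanSpace ℝ (Fin n)) T) :=
    hE.diff measurableSet_closedBall
  have hmz : Measurable fun z : EuclideanSpace ℝ (Fin n) =>
      ENNReal.ofReal (min ‖z‖ 1) * kernel s K z := by fun_prop
  have hm2 : Measurable fun p : EuclideanSpace ℝ (Fin n) × EuclideanSpace ℝ (Fin n) =>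
      (E \ Metric.closedBall 0 T).indicator 1 p.2 *
        (ENNReal.ofReal (min ‖p.1 - p.2‖ 1) * kernel s K (p.1 - p.2)) :=
    ((measurable_one.indicator hcb).comp measurable_snd).mul
      (hmz.comp (measurable_fst.sub measurable_snd))
  rw [lintegral_prod_symm _ hm2.aemeasurable]
  have hx : ∀ y : EuclideanSpace ℝ (Fin n), ∫⁻ x : EuclideanSpace ℝ (Fin n),
      (E \ Metric.closedBall 0 T).indicator 1 y *
        (ENNReal.ofReal (min ‖x - y‖ 1) * kernel s K (x - y)) =
      (E \ Metric.closedBall 0 T).indicator 1 y *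
        ∫⁻ z, ENNReal.ofReal (min ‖z‖ 1) * kernel s K z := by
    intro y
    have hmy : Measurable fun x : EuclideanSpace ℝ (Fin n) =>
        ENNReal.ofReal (min ‖x - y‖ 1) * kernel s K (x - y) :=
      hmz.comp (measurable_id.sub_const y)
    rw [lintegral_const_mul _ hmy]
    congr 1
    exact lintegral_sub_right_eq_self (fun z => ENNReal.ofReal (min ‖z‖ 1) * kernel s K z) y
  simp only [hx]
  rw [lintegral_mul_const _ (measurable_one.indicator hcb), lintegral_indicator_one hcb, mul_comm]

/-- The isoperimetric inequality for all sets of finite measure. -/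
theorem isoConst_mul_le {n : ℕ} (hn : 1 ≤ n) {s : ℝ} (hs0 : 0 < s) (hs1 : s < 1)
    {K : Set (EuclideanSpace ℝ (Fin n))} (hK : IsConvexBody K) (hKu : IsUnconditional K)
    {E : Set (EuclideanSpace ℝ (Fin n))} (hE : MeasurableSet E) (hfin : volume E ≠ ∞) :
    isoConst s K * volume E ^ (((n : ℝ) - s) / n) ≤ fracPerimeter s K E := by
  set J := ∫⁻ z, ENNReal.ofReal (min ‖z‖ 1) * kernel s K z with hJdef
  have hJ : J ≠ ∞ := (lintegral_min_norm_mul_kernel_lt_top hn hs0 hs1 hK hKu).ne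
  have hα := exponent_pos hn hs1
  have hT : ∀ T : ℕ, isoConst s K * volume (E ∩ Metric.closedBall 0 T) ^ (((n : ℝ) - s) / n) ≤
      fracPerimeter s K E + J * volume (E \ Metric.closedBall 0 T) := by
    intro T
    have h1 : ∀ R ∈ Set.Icc (T : ℝ) (T + 1),
        isoConst s K * volume (E ∩ Metric.closedBall 0 T) ^ (((n : ℝ) - s) / n) ≤
        fracPerimeter s K E +
          interaction s K (E ∩ Metric.closedBall 0 R) (E \ Metric.closedBall 0 R) := by
      intro R hR
      refine le_trans ?_ (fracPerimeter_inter_le hK hKu hE measurableSet_closedBall)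
      refine le_trans ?_ (isoConst_mul_le_of_isBounded hn hs1 K (hE.inter measurableSet_closedBall)
        (Metric.isBounded_closedBall.subset Set.inter_subset_right))
      gcongr
      exact hR.1
    -- Averaging over the interval [T, T+1] of length one: the left side does not depend on R, and
    -- the truncation cost becomes a multiple of the tail |E \ B_T|, which tends to 0.
    calc isoConst s K * volume (E ∩ Metric.closedBall 0 T) ^ (((n : ℝ) - s) / n)
        = ∫⁻ R in Set.Icc (T : ℝ) (T + 1),
            isoConst s K * volume (E ∩ Metric.closedBall 0 T) ^ (((n : ℝ) - s) / n) := by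
          simp
      _ ≤ ∫⁻ R in Set.Icc (T : ℝ) (T + 1), (fracPerimeter s K E +
          interaction s K (E ∩ Metric.closedBall 0 R) (E \ Metric.closedBall 0 R)) :=
          setLIntegral_mono' measurableSet_Icc h1
      _ = fracPerimeter s K E + ∫⁻ R in Set.Icc (T : ℝ) (T + 1),
          interaction s K (E ∩ Metric.closedBall 0 R) (E \ Metric.closedBall 0 R) := by
          rw [lintegral_add_left measurable_const]
          simp
      _ ≤ _ := by
          gcongr
          exact lintegral_interaction_closedBall_le hK hKu hE T
  have hcov : ⋃ T : ℕ, E ∩ Metric.closedBall 0 (T : ℝ) = E := by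
    rw [← Set.inter_iUnion, Metric.iUnion_closedBall_nat, Set.inter_univ]
  have hmono : Monotone fun T : ℕ => E ∩ Metric.closedBall 0 (T : ℝ) := fun a b hab =>
    Set.inter_subset_inter_right _ (Metric.closedBall_subset_closedBall (by exact_mod_cast hab))
  have hlim1 := tendsto_measure_iUnion_atTop (μ := volume) hmono
  rw [hcov] at hlim1
  have hanti : Antitone fun T : ℕ => E \ Metric.closedBall 0 (T : ℝ) := fun a b hab =>
    Set.sdiff_subset_sdiff_right (Metric.closedBall_subset_closedBall (by exact_mod_cast hab))
  have hlim2 := tendsto_measure_iInter_atTop (μ := volume)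
    (fun T : ℕ => (hE.diff (measurableSet_closedBall (x := 0) (ε := (T : ℝ)))).nullMeasurableSet)
    hanti ⟨0, measure_ne_top_of_subset Set.sdiff_subset hfin⟩
  have hempty : ⋂ T : ℕ, E \ Metric.closedBall 0 (T : ℝ) = ∅ := by
    rw [← Set.sdiff_iUnion, Metric.iUnion_closedBall_nat, Set.sdiff_univ]
  rw [hempty, measure_empty] at hlim2
  have hγ := (isoConst_lt_top hn hs0 hs1 hK hKu).ne
  have hl : Filter.Tendsto (fun T : ℕ => isoConst s K *
      volume (E ∩ Metric.closedBall 0 (T : ℝ)) ^ (((n : ℝ) - s) / n)) Filter.atTop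
      (nhds (isoConst s K * volume E ^ (((n : ℝ) - s) / n))) :=
    ENNReal.Tendsto.const_mul ((ENNReal.continuous_rpow_const.tendsto _).comp hlim1) (Or.inr hγ)
  have hr : Filter.Tendsto (fun T : ℕ => fracPerimeter s K E +
      J * volume (E \ Metric.closedBall 0 (T : ℝ))) Filter.atTop
      (nhds (fracPerimeter s K E + J * 0)) :=
    (ENNReal.Tendsto.const_mul hlim2 (Or.inr hJ)).const_add _
  rw [mul_zero, add_zero] at hr
  exact le_of_tendsto_of_tendsto' hl hr hT


/-! ### Symmetry and monotonicity of minimizers -/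

theorem measurableSet_preimage_add {n : ℕ} {E : Set (EuclideanSpace ℝ (Fin n))}
    (hE : MeasurableSet E) (c : EuclideanSpace ℝ (Fin n)) :
    MeasurableSet ((fun x => c + x) ⁻¹' E) := measurable_const_add c hE

theorem isBounded_preimage_add {n : ℕ} {E : Set (EuclideanSpace ℝ (Fin n))}
    (hE : Bornology.IsBounded E) (c : EuclideanSpace ℝ (Fin n)) :
    Bornology.IsBounded ((fun x => c + x) ⁻¹' E) := by
  obtain ⟨R, hR⟩ := hE.subset_closedBall 0
  refine (Metric.isBounded_closedBall (x := (0 : EuclideanSpace ℝ (Fin n)))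
    (r := R + ‖c‖)).subset fun x hx => ?_
  have := hR hx
  rw [mem_closedBall_zero_iff] at this ⊢
  have h2 := norm_sub_le (c + x) c
  rw [add_sub_cancel_left] at h2
  linarith

theorem volume_preimage_add {n : ℕ} (E : Set (EuclideanSpace ℝ (Fin n)))
    (c : EuclideanSpace ℝ (Fin n)) : volume ((fun x => c + x) ⁻¹' E) = volume E :=
  measure_preimage_add volume c E

theorem IsMinimizer.preimage_add {n : ℕ} {s : ℝ} {K M : Set (EuclideanSpace ℝ (Fin n))}
    (hM : IsMinimizer s K M) (c : EuclideanSpace ℝ (Fin n)) :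
    IsMinimizer s K ((fun x => c + x) ⁻¹' M) where
  measurableSet := measurableSet_preimage_add hM.measurableSet c
  isBounded := isBounded_preimage_add hM.isBounded c
  volume_pos := by rw [volume_preimage_add]; exact hM.volume_pos
  eq_isoConst := by rw [volume_preimage_add, fracPerimeter_preimage_add, hM.eq_isoConst]

theorem IsMinimizer.volume_ne_top {n : ℕ} {s : ℝ} {K M : Set (EuclideanSpace ℝ (Fin n))}
    (hM : IsMinimizer s K M) : volume M ≠ ∞ := hM.isBounded.measure_lt_top.ne

/-- The polarization of M is a bounded competitor of the same volume, so its perimeter cannot be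
smaller. -/
theorem IsMinimizer.reflection_comparable {n : ℕ} {s : ℝ} (hs0 : 0 < s) (hs1 : s < 1)
    {K M : Set (EuclideanSpace ℝ (Fin n))} (hK : IsConvexBody K) (hKu : IsUnconditional K)
    (hKs : StrictConvex ℝ K) (hM : IsMinimizer s K M) (i : Fin n) :
    (∀ᵐ x : EuclideanSpace ℝ (Fin n), x i < 0 → x ∈ M → coordReflection i x ∈ M) ∨
      (∀ᵐ x : EuclideanSpace ℝ (Fin n), x i < 0 → coordReflection i x ∈ M → x ∈ M) := by
  have hn : 1 ≤ n := i.pos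
  refine reflection_comparable_of_le_polarization hs0 hK hKu hKs i hM.measurableSet ?_ ?_
  · rw [hM.eq_isoConst]
    exact ENNReal.mul_ne_top (isoConst_lt_top hn hs0 hs1 hK hKu).ne
      (ENNReal.rpow_ne_top_of_nonneg (exponent_pos hn hs1).le hM.volume_ne_top)
  · rw [hM.eq_isoConst, ← volume_polarization i hM.measurableSet]
    exact isoConst_mul_le_of_isBounded hn hs1 K (measurableSet_polarization i hM.measurableSet)
      (isBounded_polarization i hM.isBounded)

theorem ae_coordReflection {n : ℕ} (i : Fin n) {p : EuclideanSpace ℝ (Fin n) → Prop}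
    (h : ∀ᵐ x, p x) : ∀ᵐ x, p (coordReflection i x) :=
  (measurePreserving_coordReflection i).quasiMeasurePreserving.ae h

theorem ae_add_right {n : ℕ} (c : EuclideanSpace ℝ (Fin n)) {p : EuclideanSpace ℝ (Fin n) → Prop}
    (h : ∀ᵐ x, p x) : ∀ᵐ x, p (x + c) :=
  (measurePreserving_add_right volume c).quasiMeasurePreserving.ae h

/-- A bounded set which is almost everywhere contained in a proper translate of itself is null. -/
theorem volume_eq_zero_of_ae_add_mem {n : ℕ} {A : Set (EuclideanSpace ℝ (Fin n))}
    (hA : Bornology.IsBounded A) {d : EuclideanSpace ℝ (Fin n)} (hd : d ≠ 0)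
    (h : ∀ᵐ x, x ∈ A → x + d ∈ A) : volume A = 0 := by
  -- Iterating the shift eventually moves points farther than the diameter of a ball containing A.
  have hk : ∀ k : ℕ, ∀ᵐ x, x ∈ A → x + (k : ℝ) • d ∈ A := by
    intro k
    induction k with
    | zero => simp
    | succ k ih =>
      filter_upwards [ih, ae_add_right ((k : ℝ) • d) h] with x h1 h2 hx
      have := h2 (h1 hx)
      rwa [add_assoc, show (k : ℝ) • d + d = ((k + 1 : ℕ) : ℝ) • d by
        rw [Nat.cast_succ, add_smul, one_smul]] at this
  obtain ⟨R, hR⟩ := hA.subset_closedBall 0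
  obtain ⟨k, hkR⟩ := exists_nat_gt (2 * R / ‖d‖)
  rw [div_lt_iff₀ (norm_pos_iff.2 hd)] at hkR
  rw [measure_eq_zero_iff_ae_notMem]
  filter_upwards [hk k] with x h1 hx
  have h2 := hR hx
  have h3 := hR (h1 hx)
  rw [mem_closedBall_zero_iff] at h2 h3
  have h4 := norm_sub_le (x + (k : ℝ) • d) x
  rw [add_sub_cancel_left, norm_smul, Real.norm_natCast] at h4
  linarith

theorem exists_median {n : ℕ} (i : Fin n) {M : Set (EuclideanSpace ℝ (Fin n))}
    (hMb : Bornology.IsBounded M) :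
    ∃ a : ℝ, volume (M ∩ {x | x i < a}) = volume (M ∩ {x | a < x i}) := by
  have hfinM : volume M ≠ ∞ := hMb.measure_lt_top.ne
  have : IsFiniteMeasure (volume.restrict M) := ⟨by simpa using hMb.measure_lt_top⟩
  set ν : Measure ℝ := (volume.restrict M).map (fun x => x i)
  have hi := measurable_coord (n := n) i
  have hν : ∀ S, MeasurableSet S → ν S = volume ((fun x => x i) ⁻¹' S ∩ M) := fun S hS => by
    rw [Measure.map_apply hi hS, Measure.restrict_apply (hi hS)]
  have hna : NullSingletonClass ν := ⟨fun a => by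
    rw [hν _ (measurableSet_singleton a)]
    exact measure_mono_null Set.inter_subset_left (volume_hyperplane i a)⟩
  obtain ⟨R, hR0, hR⟩ := hMb.subset_closedBall_lt 0 0
  have hbd : ∀ x ∈ M, |x i| ≤ R := fun x hx => by
    have := hR hx
    rw [mem_closedBall_zero_iff] at this
    exact (PiLp.norm_apply_le x i).trans this
  -- The distribution function of the i-th coordinate on M, based to the left of M. It is continuous
  -- because hyperplanes are null, so it attains half the volume.
  set g : ℝ → ℝ := fun a => ∫ _ in (-R - 1)..a, (1 : ℝ) ∂ν with hg
  have hgc : Continuous g := intervalIntegral.continuous_primitive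
    (fun _ _ => intervalIntegrable_const) _
  have hgval : ∀ a, -R - 1 ≤ a → g a = (volume (M ∩ {x | x i < a})).toReal := by
    intro a ha
    rw [hg]
    simp only
    rw [intervalIntegral.integral_of_le ha, setIntegral_const, smul_eq_mul, mul_one,
      Measure.real, hν _ measurableSet_Ioc]
    congr 1
    refine measure_congr ?_
    filter_upwards [ae_coord_ne i a] with x hx
    apply propext
    change (x i ∈ Set.Ioc _ _ ∧ x ∈ M) ↔ (x ∈ M ∧ x i < a)
    constructor
    · rintro ⟨h1, h2⟩; exact ⟨h2, lt_of_le_of_ne h1.2 hx⟩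
    · rintro ⟨h1, h2⟩
      exact ⟨⟨by linarith [(abs_le.1 (hbd x h1)).1], h2.le⟩, h1⟩
  have h0 : g (-R - 1) = 0 := by simp [hg]
  have h1 : g (R + 1) = (volume M).toReal := by
    rw [hgval _ (by linarith)]
    congr 2
    refine Set.inter_eq_left.2 fun x hx => ?_
    change x i < R + 1
    linarith [(abs_le.1 (hbd x hx)).2]
  have hmem : (volume M).toReal / 2 ∈ Set.Icc (g (-R - 1)) (g (R + 1)) := by
    rw [h0, h1]
    have : 0 ≤ (volume M).toReal := ENNReal.toReal_nonneg
    constructor <;> linarith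
  obtain ⟨a, ha, hga⟩ := intermediate_value_Icc (by linarith) hgc.continuousOn hmem
  rw [hgval a ha.1] at hga
  refine ⟨a, ?_⟩
  have hlt : MeasurableSet {x : EuclideanSpace ℝ (Fin n) | x i < a} :=
    measurableSet_lt hi measurable_const
  have hsum := measure_inter_add_sdiff (μ := volume) M hlt
  have hae : volume (M \ {x | x i < a}) = volume (M ∩ {x | a < x i}) := by
    refine measure_congr ?_
    filter_upwards [ae_coord_ne i a] with x hx
    apply propext
    change (x ∈ M ∧ ¬ (x i < a)) ↔ (x ∈ M ∧ a < x i)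
    rw [not_lt, le_iff_lt_or_eq, or_iff_left hx.symm]
  rw [hae] at hsum
  have hf1 : volume (M ∩ {x | x i < a}) ≠ ∞ := measure_ne_top_of_subset Set.inter_subset_left hfinM
  have hf2 : volume (M ∩ {x | a < x i}) ≠ ∞ := measure_ne_top_of_subset Set.inter_subset_left hfinM
  rw [← ENNReal.toReal_eq_toReal_iff' hf1 hf2]
  have := congrArg ENNReal.toReal hsum
  rw [ENNReal.toReal_add hf1 hf2] at this
  linarith

theorem exists_medians {n : ℕ} {M : Set (EuclideanSpace ℝ (Fin n))}
    (hMb : Bornology.IsBounded M) :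
    ∃ c : EuclideanSpace ℝ (Fin n), ∀ i,
      volume ((fun x => c + x) ⁻¹' M ∩ {x | x i < 0}) =
        volume ((fun x => c + x) ⁻¹' M ∩ {x | 0 < x i}) := by
  choose a ha using fun i => exists_median i hMb
  refine ⟨WithLp.toLp 2 a, fun i => ?_⟩
  have h := ha i
  rw [← volume_preimage_add _ (WithLp.toLp 2 a),
    ← volume_preimage_add (M ∩ {x | a i < x i}) (WithLp.toLp 2 a)] at h
  convert h using 2
  · ext x
    change _ ∧ x i < 0 ↔ _ ∧ a i + x i < a i
    rw [add_lt_iff_neg_left]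
    rfl
  · ext x
    change _ ∧ 0 < x i ↔ _ ∧ a i < a i + x i
    rw [lt_add_iff_pos_right]
    rfl

/-- A minimizer that is balanced with respect to a coordinate hyperplane is symmetric. -/
theorem IsMinimizer.ae_symmetric {n : ℕ} {s : ℝ} (hs0 : 0 < s) (hs1 : s < 1)
    {K M : Set (EuclideanSpace ℝ (Fin n))} (hK : IsConvexBody K) (hKu : IsUnconditional K)
    (hKs : StrictConvex ℝ K) (hM : IsMinimizer s K M) (i : Fin n)
    (hmed : volume (M ∩ {x | x i < 0}) = volume (M ∩ {x | 0 < x i})) :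
    ∀ᵐ x, coordReflection i x ∈ M ↔ x ∈ M := by
  have hσ := measurePreserving_coordReflection i
  have hfin := hM.volume_ne_top
  have hi := measurable_coord (n := n) i
  have hneg : MeasurableSet (M ∩ {x | x i < 0}) :=
    hM.measurableSet.inter (measurableSet_lt hi measurable_const)
  have hpos : MeasurableSet (M ∩ {x | 0 < x i}) :=
    hM.measurableSet.inter (measurableSet_lt measurable_const hi)
  have hpre : coordReflection i ⁻¹' (M ∩ {x | 0 < x i}) =
      {x | x i < 0 ∧ coordReflection i x ∈ M} := by
    ext x
    change (_ ∧ 0 < coordReflection i x i) ↔ (x i < 0 ∧ _)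
    rw [coordReflection_same, neg_pos, and_comm]
  have hvol : volume {x | x i < 0 ∧ coordReflection i x ∈ M} = volume (M ∩ {x | x i < 0}) := by
    rw [← hpre, hσ.measure_preimage hpos.nullMeasurableSet, hmed]
  have hmeas : MeasurableSet {x | x i < 0 ∧ coordReflection i x ∈ M} := by
    rw [← hpre]; exact hσ.measurable hpos
  -- One of the two sets contains the other almost everywhere, and they have equal finite volume.
  have hae : (M ∩ {x | x i < 0} : Set _) =ᵐ[volume]
      {x | x i < 0 ∧ coordReflection i x ∈ M} := by
    rcases hM.reflection_comparable hs0 hs1 hK hKu hKs i with h | h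
    · refine ae_eq_of_ae_subset_of_measure_ge ?_ hvol.le hneg.nullMeasurableSet ?_
      · filter_upwards [h] with x hx h1
        exact ⟨h1.2, hx h1.2 h1.1⟩
      · rw [hvol]; exact measure_ne_top_of_subset Set.inter_subset_left hfin
    · refine (ae_eq_of_ae_subset_of_measure_ge ?_ hvol.ge hmeas.nullMeasurableSet ?_).symm
      · filter_upwards [h] with x hx h1
        exact ⟨hx h1.1 h1.2, h1.1⟩
      · exact measure_ne_top_of_subset Set.inter_subset_left hfin
  have hae' : ∀ᵐ x : EuclideanSpace ℝ (Fin n), x i < 0 → (coordReflection i x ∈ M ↔ x ∈ M) := by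
    filter_upwards [hae] with x hx h0
    have h1 : (x ∈ M ∧ x i < 0) ↔ (x i < 0 ∧ coordReflection i x ∈ M) := iff_of_eq hx
    exact ⟨fun h => (h1.2 ⟨h0, h⟩).1, fun h => (h1.1 ⟨h, h0⟩).2⟩
  filter_upwards [hae', ae_coordReflection i hae', ae_coord_ne i 0] with x h1 h2 h3
  rcases lt_or_gt_of_ne h3 with h | h
  · exact h1 h
  · have := h2 (by rw [coordReflection_same]; linarith)
    rw [coordReflection_involutive] at this
    exact this.symm

/-- A minimizer symmetric in a coordinate direction is decreasing in this direction. -/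
theorem IsMinimizer.ae_monotone {n : ℕ} {s : ℝ} (hs0 : 0 < s) (hs1 : s < 1)
    {K M : Set (EuclideanSpace ℝ (Fin n))} (hK : IsConvexBody K) (hKu : IsUnconditional K)
    (hKs : StrictConvex ℝ K) (hM : IsMinimizer s K M) (i : Fin n)
    (hsym : ∀ᵐ x, coordReflection i x ∈ M ↔ x ∈ M) {t : ℝ} (ht : 0 < t) :
    ∀ᵐ x, 0 < x i → x + EuclideanSpace.single i t ∈ M → x ∈ M := by
  set e := EuclideanSpace.single i (t / 2) with he
  have hee : e + e = EuclideanSpace.single i t := by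
    ext j
    by_cases hj : j = i <;> simp [he, hj]
  have hei : e i = t / 2 := by simp [he]
  have hσe : coordReflection i e = -e := by
    ext j
    by_cases hj : j = i <;> simp [he, coordReflection_apply, hj]
  have hd : EuclideanSpace.single i t ≠ (0 : EuclideanSpace ℝ (Fin n)) := fun h => by
    have := congrArg (fun v : EuclideanSpace ℝ (Fin n) => v i) h
    simp at this
    exact ht.ne' this
  -- Translating by e, half the desired shift, means reflecting M in the hyperplane x_i = t/2.
  -- Composed with the symmetry in x_i = 0, this is the translation by t.
  rcases (hM.preimage_add e).reflection_comparable hs0 hs1 hK hKu hKs i with h | h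
  -- The wrong alternative would map the part of M with x_i > -t/2 into itself under the shift by t.
  -- That part would be null, and by symmetry so would M.
  · exfalso
    have h1 : ∀ᵐ x : EuclideanSpace ℝ (Fin n), -(t / 2) < x i → x ∈ M →
        x + EuclideanSpace.single i t ∈ M := by
      filter_upwards [ae_add_right e (ae_coordReflection i h), hsym] with x h1 h2 h3 h4
      have h5 := h1 (by simp only [coordReflection_same, PiLp.add_apply, hei]; linarith) (by
        change e + coordReflection i (x + e) ∈ M
        rw [coordReflection_add, hσe, add_comm, neg_add_cancel_right]
        exact h2.2 h4)
      rw [coordReflection_involutive] at h5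
      change e + (x + e) ∈ M at h5
      rwa [add_comm, add_assoc, hee] at h5
    have h2 : volume (M ∩ {x | -(t / 2) < x i}) = 0 := by
      refine volume_eq_zero_of_ae_add_mem (hM.isBounded.subset Set.inter_subset_left) hd ?_
      filter_upwards [h1] with x hx h3
      refine ⟨hx h3.2 h3.1, ?_⟩
      have : -(t / 2) < x i := h3.2
      change -(t / 2) < (x + EuclideanSpace.single i t) i
      simp only [PiLp.add_apply, PiLp.single_apply, if_true]
      linarith
    rw [measure_eq_zero_iff_ae_notMem] at h2
    refine hM.volume_pos.ne' ?_
    rw [measure_eq_zero_iff_ae_notMem]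
    filter_upwards [h2, ae_coordReflection i h2, hsym] with x h3 h4 h5 h6
    rcases le_or_gt 0 (x i) with h7 | h7
    · exact h3 ⟨h6, show -(t / 2) < x i by linarith⟩
    · refine h4 ⟨h5.2 h6, ?_⟩
      change -(t / 2) < coordReflection i x i
      rw [coordReflection_same]
      linarith
  · have h1 : ∀ᵐ x : EuclideanSpace ℝ (Fin n), 0 < x i → x + e ∈ M → x - e ∈ M := by
      filter_upwards [ae_coordReflection i h, ae_add_right (-e) hsym] with x h1 h2 h3 h4
      have h5 := h1 (by simp only [coordReflection_same]; linarith) (by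
        change e + coordReflection i (coordReflection i x) ∈ M
        rwa [coordReflection_involutive, add_comm])
      change e + coordReflection i x ∈ M at h5
      rw [coordReflection_add, ← hσe, coordReflection_involutive] at h2
      rw [hσe, ← sub_eq_add_neg] at h2
      rw [add_comm] at h5
      exact h2.1 h5
    filter_upwards [ae_add_right e h1] with x h2 h3 h4
    have := h2 (by rw [PiLp.add_apply, hei]; linarith) (by rwa [add_assoc, hee])
    rwa [add_sub_cancel_right] at this


/-! ### Box-monotone open sets are star bodies -/

/-- Sets containing with a point the whole coordinate box spanned by it. -/
def IsBoxMonotone {n : ℕ} (L : Set (EuclideanSpace ℝ (Fin n))) : Prop :=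
  ∀ x ∈ L, ∀ y : EuclideanSpace ℝ (Fin n), (∀ j, |y j| ≤ |x j|) → y ∈ L

theorem IsBoxMonotone.isUnconditional {n : ℕ} {L : Set (EuclideanSpace ℝ (Fin n))}
    (hL : IsBoxMonotone L) : IsUnconditional L := fun i x hx => hL x hx _ fun j => by
  rw [coordReflection_apply]
  split_ifs <;> simp

theorem IsBoxMonotone.smul_mem {n : ℕ} {L : Set (EuclideanSpace ℝ (Fin n))}
    (hL : IsBoxMonotone L) {x : EuclideanSpace ℝ (Fin n)} (hx : x ∈ L) {t : ℝ} (ht0 : 0 ≤ t)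
    (ht1 : t ≤ 1) : t • x ∈ L := hL x hx _ fun j => by
  rw [PiLp.smul_apply, smul_eq_mul, abs_mul, abs_of_nonneg ht0]
  exact mul_le_of_le_one_left (abs_nonneg _) ht1

/-- A point w of L close to z satisfies t|z_j| < |w_j| wherever z_j ≠ 0, so its box contains t z.
Hence a ray cannot run along the boundary of L, which is what continuity of the radial function
requires. -/
theorem IsBoxMonotone.smul_mem_of_mem_closure {n : ℕ} {L : Set (EuclideanSpace ℝ (Fin n))}
    (hL : IsBoxMonotone L) {z : EuclideanSpace ℝ (Fin n)} (hz : z ∈ closure L) {t : ℝ}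
    (ht0 : 0 ≤ t) (ht1 : t < 1) : t • z ∈ L := by
  have hU : IsOpen {w : EuclideanSpace ℝ (Fin n) | ∀ j, z j ≠ 0 → t * |z j| < |w j|} := by
    have : {w : EuclideanSpace ℝ (Fin n) | ∀ j, z j ≠ 0 → t * |z j| < |w j|} =
        ⋂ j, {w : EuclideanSpace ℝ (Fin n) | z j ≠ 0 → t * |z j| < |w j|} := by
      ext w; simp
    rw [this]
    refine isOpen_iInter_of_finite fun j => ?_
    by_cases h : z j = 0
    · simp [h]
    · simp only [ne_eq, h, not_false_eq_true, forall_const]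
      exact isOpen_lt continuous_const (by fun_prop)
  have hzU : z ∈ {w : EuclideanSpace ℝ (Fin n) | ∀ j, z j ≠ 0 → t * |z j| < |w j|} :=
    fun j hj => mul_lt_of_lt_one_left (abs_pos.2 hj) ht1
  obtain ⟨w, hwU, hwL⟩ := mem_closure_iff.1 hz _ hU hzU
  refine hL w hwL _ fun j => ?_
  rw [PiLp.smul_apply, smul_eq_mul, abs_mul, abs_of_nonneg ht0]
  by_cases h : z j = 0
  · simp [h]
  · exact (hwU j h).le

theorem bddAbove_radial {n : ℕ} {L : Set (EuclideanSpace ℝ (Fin n))}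
    (hb : Bornology.IsBounded L) {x : EuclideanSpace ℝ (Fin n)} (hx : x ≠ 0) :
    BddAbove {t : ℝ | 0 ≤ t ∧ t • x ∈ L} := by
  obtain ⟨R, hR⟩ := hb.subset_closedBall 0
  refine ⟨R / ‖x‖, fun t ht => ?_⟩
  have := hR ht.2
  rw [mem_closedBall_zero_iff, norm_smul, Real.norm_of_nonneg ht.1] at this
  rwa [le_div_iff₀ (norm_pos_iff.2 hx)]

theorem IsBoxMonotone.isStarBody {n : ℕ} {L : Set (EuclideanSpace ℝ (Fin n))}
    (hL : IsBoxMonotone L) (ho : IsOpen L) (hb : Bornology.IsBounded L) (hne : L.Nonempty) :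
    IsStarBody L := by
  obtain ⟨p, hp⟩ := hne
  have h0 : (0 : EuclideanSpace ℝ (Fin n)) ∈ L := hL p hp 0 fun j => by simp
  refine ⟨hb, ?_, by rwa [ho.interior_eq], ?_⟩
  · intro y hy a b ha hb' hab
    rw [smul_zero, zero_add]
    exact hL.smul_mem hy hb' (by linarith)
  · intro x hx
    have hx0 : x ≠ 0 := hx
    refine ContinuousAt.continuousWithinAt ?_
    have hne0 : ∀ᶠ y in nhds x, y ≠ 0 := isOpen_ne.mem_nhds hx0
    have hmem0 : ∀ y : EuclideanSpace ℝ (Fin n), (0 : ℝ) ∈ {t : ℝ | 0 ≤ t ∧ t • y ∈ L} :=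
      fun y => ⟨le_rfl, by rwa [zero_smul]⟩
    refine tendsto_order.2 ⟨fun c hc => ?_, fun c hc => ?_⟩
    -- Lower semicontinuity follows from openness of L.
    · obtain ⟨t, ht, hct⟩ := exists_lt_of_lt_csSup ⟨0, hmem0 x⟩ hc
      have : ∀ᶠ y in nhds x, t • y ∈ L :=
        (continuous_const_smul t).continuousAt.eventually (ho.mem_nhds ht.2)
      filter_upwards [this, hne0] with y hy hy0
      exact hct.trans_le (le_csSup (bddAbove_radial hb hy0) ⟨ht.1, hy⟩)
    · obtain ⟨c', hc1, hc2⟩ := exists_between hc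
      have hc0 : 0 < c' := lt_of_le_of_lt (le_csSup (bddAbove_radial hb hx0) (hmem0 x)) hc1
      -- Upper semicontinuity: if a point beyond the radial value were in the closure, all shorter
      -- multiples would lie in L. Its exclusion from the closure persists for nearby directions.
      have hnot : c' • x ∉ closure L := by
        intro h
        refine absurd hc1 (not_lt.2 ?_)
        refine le_of_forall_lt fun d hd => ?_
        obtain ⟨d', hd1, hd2⟩ := exists_between (max_lt hd hc0)
        have hd0 : 0 < d' := (le_max_right _ _).trans_lt hd1
        have h1 := hL.smul_mem_of_mem_closure h (t := d' / c') (by positivity)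
          ((div_lt_one hc0).2 hd2)
        rw [smul_smul, div_mul_cancel₀ _ hc0.ne'] at h1
        exact ((le_max_left _ _).trans_lt hd1).trans_le
          (le_csSup (bddAbove_radial hb hx0) ⟨hd0.le, h1⟩)
      have : ∀ᶠ y in nhds x, c' • y ∈ (closure L)ᶜ :=
        (continuous_const_smul c').continuousAt.eventually
          (isClosed_closure.isOpen_compl.mem_nhds hnot)
      filter_upwards [this] with y hy
      refine lt_of_le_of_lt (csSup_le ⟨0, hmem0 y⟩ fun t ht => ?_) hc2
      by_contra hlt
      rw [not_le] at hlt
      refine hy (subset_closure ?_)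
      have ht0 : 0 < t := hc0.trans hlt
      have := hL.smul_mem ht.2 (t := c' / t) (by positivity) ((div_le_one ht0).2 hlt.le)
      rwa [smul_smul, div_mul_cancel₀ _ ht0.ne'] at this

/-! ### The box-monotone representative -/

/-- The vector of the absolute values of the coordinates. -/
noncomputable def absVec {n : ℕ} (x : EuclideanSpace ℝ (Fin n)) : EuclideanSpace ℝ (Fin n) :=
  WithLp.toLp 2 fun j => |x j|

theorem absVec_apply {n : ℕ} (x : EuclideanSpace ℝ (Fin n)) (j : Fin n) : absVec x j = |x j| := rfl

theorem absVec_of_pos {n : ℕ} {x : EuclideanSpace ℝ (Fin n)} (hx : ∀ j, 0 < x j) :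
    absVec x = x := by
  ext j
  rw [absVec_apply, abs_of_pos (hx j)]

/-- The points `x` such that `M` has positive mass in the open orthant above `|x|`. -/
def boxRep {n : ℕ} (M : Set (EuclideanSpace ℝ (Fin n))) : Set (EuclideanSpace ℝ (Fin n)) :=
  {x | volume {h : EuclideanSpace ℝ (Fin n) | (∀ j, 0 < h j) ∧ absVec x + h ∈ M} ≠ 0}

/-- Moving the base point from |x| to |y| keeps the mass in the open orthant above it. The margin δ
= 0 yields box monotonicity, and δ > 0 yields openness. -/
theorem mem_boxRep_of_le_add {n : ℕ} {M : Set (EuclideanSpace ℝ (Fin n))} {δ : ℝ}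
    {x y : EuclideanSpace ℝ (Fin n)} (hxy : ∀ j, |y j| ≤ |x j| + δ)
    (hx : volume {h : EuclideanSpace ℝ (Fin n) | (∀ j, δ < h j) ∧ absVec x + h ∈ M} ≠ 0) :
    y ∈ boxRep M := by
  intro h0
  apply hx
  rw [← volume_preimage_add _ (absVec x - absVec y)] at h0
  refine measure_mono_null ?_ h0
  rintro h ⟨h1, h2⟩
  refine ⟨fun j => ?_, ?_⟩
  · have h3 := hxy j
    have h4 := h1 j
    simp only [PiLp.add_apply, PiLp.sub_apply, absVec_apply]
    linarith
  · rwa [← add_assoc, add_sub_cancel]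

theorem isBoxMonotone_boxRep {n : ℕ} (M : Set (EuclideanSpace ℝ (Fin n))) :
    IsBoxMonotone (boxRep M) := fun x hx y hy =>
  mem_boxRep_of_le_add (δ := 0) (fun j => by rw [add_zero]; exact hy j) hx

/-- The open orthant is the increasing union of the orthants h_j > 1/(k+1). One of these already
carries positive mass, and this leaves room 1/(k+1) for moving x. -/
theorem isOpen_boxRep {n : ℕ} (M : Set (EuclideanSpace ℝ (Fin n))) : IsOpen (boxRep M) := by
  rw [isOpen_iff_mem_nhds]
  intro x hx
  have hun : {h : EuclideanSpace ℝ (Fin n) | (∀ j, 0 < h j) ∧ absVec x + h ∈ M} ⊆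
      ⋃ k : ℕ, {h | (∀ j, 1 / ((k : ℝ) + 1) < h j) ∧ absVec x + h ∈ M} := by
    rintro h ⟨h1, h2⟩
    have h3 : ∃ k : ℕ, ∀ j, 1 / ((k : ℝ) + 1) < h j := by
      have h4 : ∀ᶠ k : ℕ in Filter.atTop, ∀ j, 1 / ((k : ℝ) + 1) < h j :=
        Filter.eventually_all.2 fun j =>
          tendsto_one_div_add_atTop_nhds_zero_nat.eventually (gt_mem_nhds (h1 j))
      exact h4.exists
    obtain ⟨k, hk⟩ := h3
    exact Set.mem_iUnion.2 ⟨k, hk, h2⟩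
  have hex : ∃ k : ℕ, volume {h : EuclideanSpace ℝ (Fin n) |
      (∀ j, 1 / ((k : ℝ) + 1) < h j) ∧ absVec x + h ∈ M} ≠ 0 := by
    by_contra hcon
    push Not at hcon
    exact hx (measure_mono_null hun (measure_iUnion_null hcon))
  obtain ⟨k, hk⟩ := hex
  have hU : ∀ᶠ y : EuclideanSpace ℝ (Fin n) in nhds x, ∀ j, |y j| < |x j| + 1 / ((k : ℝ) + 1) := by
    refine Filter.eventually_all.2 fun j => ?_
    have hc : Continuous fun y : EuclideanSpace ℝ (Fin n) => |y j| := by fun_prop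
    exact hc.continuousAt.eventually (gt_mem_nhds (lt_add_of_pos_right _ (by positivity)))
  filter_upwards [hU] with y hy
  exact mem_boxRep_of_le_add (fun j => (hy j).le) hk

theorem isBounded_boxRep {n : ℕ} {M : Set (EuclideanSpace ℝ (Fin n))}
    (hM : Bornology.IsBounded M) : Bornology.IsBounded (boxRep M) := by
  obtain ⟨R, hR⟩ := hM.subset_closedBall 0
  refine (Metric.isBounded_closedBall (x := (0 : EuclideanSpace ℝ (Fin n))) (r := R)).subset ?_
  intro x hx
  obtain ⟨h, h1, h2⟩ := nonempty_of_measure_ne_zero hx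
  have h3 := hR h2
  rw [mem_closedBall_zero_iff] at h3 ⊢
  refine le_trans ?_ h3
  rw [EuclideanSpace.norm_eq, EuclideanSpace.norm_eq]
  refine Real.sqrt_le_sqrt (Finset.sum_le_sum fun j _ => ?_)
  rw [Real.norm_eq_abs, Real.norm_eq_abs, PiLp.add_apply, absVec_apply]
  refine pow_le_pow_left₀ (abs_nonneg _) ?_ 2
  refine le_trans ?_ (le_abs_self _)
  linarith [h1 j]

/-- The shift is built up one coordinate at a time. The coordinate being shifted has not been moved
yet, so it is still positive. -/
theorem ae_monotone_orthant {n : ℕ} {M : Set (EuclideanSpace ℝ (Fin n))}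
    (hT : ∀ i : Fin n, ∀ t : ℝ, 0 < t →
      ∀ᵐ x, 0 < x i → x + EuclideanSpace.single i t ∈ M → x ∈ M)
    {h : EuclideanSpace ℝ (Fin n)} (hh : ∀ j, 0 < h j) :
    ∀ᵐ x : EuclideanSpace ℝ (Fin n), (∀ j, 0 < x j) → x + h ∈ M → x ∈ M := by
  have key : ∀ S : Finset (Fin n), ∀ᵐ x : EuclideanSpace ℝ (Fin n), (∀ j, 0 < x j) →
      x + WithLp.toLp 2 (fun j => if j ∈ S then h j else 0) ∈ M → x ∈ M := by
    intro S
    induction S using Finset.induction_on with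
    | empty =>
      have : (WithLp.toLp 2 fun _ => (0 : ℝ) : EuclideanSpace ℝ (Fin n)) = 0 := rfl
      simp [this]
    | insert i S hi ih =>
      filter_upwards [ih, ae_add_right (WithLp.toLp 2 fun j => if j ∈ S then h j else 0)
        (hT i (h i) (hh i))] with x h1 h2 h3 h4
      refine h1 h3 (h2 ?_ ?_)
      · simpa [hi] using h3 i
      · convert h4 using 1
        ext j
        by_cases hj : j = i
        · subst hj; simp [hi]
        · simp [hj]
  have := key Finset.univ
  simpa using this

theorem measurable_add_prod {n : ℕ} :
    Measurable fun p : EuclideanSpace ℝ (Fin n) × EuclideanSpace ℝ (Fin n) => p.1 + p.2 :=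
  measurable_fst.add measurable_snd

theorem isOpen_orthant (n : ℕ) : IsOpen {x : EuclideanSpace ℝ (Fin n) | ∀ j, 0 < x j} := by
  rw [Set.ofPred_forall]
  exact isOpen_iInter_of_finite fun j => isOpen_lt continuous_const (by fun_prop)

/-- Monotonicity holds for each h outside a null set of x depending on h; Fubini exchanges the
quantifiers. If then x ∉ M, almost every x + h above x is outside M, which excludes x from the
representative. -/
theorem ae_mem_of_mem_boxRep {n : ℕ} {M : Set (EuclideanSpace ℝ (Fin n))} (hM : MeasurableSet M)
    (hT : ∀ i : Fin n, ∀ t : ℝ, 0 < t →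
      ∀ᵐ x, 0 < x i → x + EuclideanSpace.single i t ∈ M → x ∈ M) :
    ∀ᵐ x : EuclideanSpace ℝ (Fin n), (∀ j, 0 < x j) → x ∈ boxRep M → x ∈ M := by
  have hQ := (isOpen_orthant n).measurableSet
  have hms : MeasurableSet {p : EuclideanSpace ℝ (Fin n) × EuclideanSpace ℝ (Fin n) |
      (∀ j, 0 < p.1 j) → (∀ j, 0 < p.2 j) → p.2 + p.1 ∈ M → p.2 ∈ M} := by
    have hfst : Measurable fun p : EuclideanSpace ℝ (Fin n) × EuclideanSpace ℝ (Fin n) => p.1 :=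
      measurable_fst
    have hsnd : Measurable fun p : EuclideanSpace ℝ (Fin n) × EuclideanSpace ℝ (Fin n) => p.2 :=
      measurable_snd
    have h1 := hfst hQ
    have h2 := hsnd hQ
    have h3 := (measurable_add_prod (n := n)).comp measurable_swap hM
    have h4 := hsnd hM
    exact h1.imp (h2.imp (h3.imp h4))
  have h1 : ∀ᵐ h : EuclideanSpace ℝ (Fin n), ∀ᵐ x : EuclideanSpace ℝ (Fin n),
      (∀ j, 0 < h j) → (∀ j, 0 < x j) → x + h ∈ M → x ∈ M := by
    refine Filter.Eventually.of_forall fun h => ?_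
    by_cases hh : ∀ j, 0 < h j
    · filter_upwards [ae_monotone_orthant hT hh] with x hx _ using hx
    · exact Filter.Eventually.of_forall fun x h' => absurd h' hh
  rw [Measure.ae_ae_comm hms] at h1
  filter_upwards [h1] with x hx hxQ hxL
  by_contra hxM
  apply hxL
  rw [absVec_of_pos hxQ, measure_eq_zero_iff_ae_notMem]
  filter_upwards [hx] with h h2 h3
  exact hxM (h2 h3.1 hxQ h3.2)

theorem tendsto_volume_symmDiff_translate {n : ℕ} {M : Set (EuclideanSpace ℝ (Fin n))}
    (hM : MeasurableSet M) (hfin : volume M ≠ ∞) :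
    Filter.Tendsto (fun h : EuclideanSpace ℝ (Fin n) =>
      volume (symmDiff ((fun x => x + h) ⁻¹' M) M)) (nhds 0) (nhds 0) := by
  let F : C(EuclideanSpace ℝ (Fin n) × EuclideanSpace ℝ (Fin n), EuclideanSpace ℝ (Fin n)) :=
    ⟨fun p => p.2 + p.1, by fun_prop⟩
  have hF := F.curry.continuous.tendsto 0
  have := tendsto_measure_symmDiff_preimage_nhds_zero hF
    (Filter.Eventually.of_forall fun h => measurePreserving_add_right volume h)
    (measurePreserving_add_right volume 0) hM.nullMeasurableSet hfin
  have h0 : (F.curry 0) ⁻¹' M = M := by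
    ext x
    change x + 0 ∈ M ↔ x ∈ M
    rw [add_zero]
  rw [h0] at this
  exact this

/-- No monotonicity is needed here. For almost every positive h, almost all points of M missed by
the representative are moved out of M by the shift h, so their measure is at most that of the
symmetric difference of M with its preimage under the shift. This tends to 0 with h. -/
theorem ae_mem_boxRep_of_mem {n : ℕ} {M : Set (EuclideanSpace ℝ (Fin n))} (hM : MeasurableSet M)
    (hfin : volume M ≠ ∞) :
    ∀ᵐ x : EuclideanSpace ℝ (Fin n), (∀ j, 0 < x j) → x ∈ M → x ∈ boxRep M := by
  have hQ := (isOpen_orthant n).measurableSet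
  have hL := (isOpen_boxRep M).measurableSet
  have hms : MeasurableSet {p : EuclideanSpace ℝ (Fin n) × EuclideanSpace ℝ (Fin n) |
      (∀ j, 0 < p.2 j) → (∀ j, 0 < p.1 j) → p.1 ∉ boxRep M → p.1 + p.2 ∉ M} := by
    have hfst : Measurable fun p : EuclideanSpace ℝ (Fin n) × EuclideanSpace ℝ (Fin n) => p.1 :=
      measurable_fst
    have hsnd : Measurable fun p : EuclideanSpace ℝ (Fin n) × EuclideanSpace ℝ (Fin n) => p.2 :=
      measurable_snd
    have h1 := hfst hQ
    have h2 := hsnd hQ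
    have h3 := (measurable_add_prod (n := n)) hM
    have h4 := hfst hL
    exact h2.imp (h1.imp (h4.compl.imp h3.compl))
  have h1 : ∀ᵐ x : EuclideanSpace ℝ (Fin n), ∀ᵐ h : EuclideanSpace ℝ (Fin n),
      (∀ j, 0 < h j) → (∀ j, 0 < x j) → x ∉ boxRep M → x + h ∉ M := by
    refine Filter.Eventually.of_forall fun x => ?_
    by_cases hx : (∀ j, 0 < x j) ∧ x ∉ boxRep M
    · have h2 : volume {h : EuclideanSpace ℝ (Fin n) | (∀ j, 0 < h j) ∧ absVec x + h ∈ M} = 0 :=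
        not_not.1 hx.2
      rw [absVec_of_pos hx.1, measure_eq_zero_iff_ae_notMem] at h2
      filter_upwards [h2] with h h3 h4 _ _ h5 using h3 ⟨h4, h5⟩
    · exact Filter.Eventually.of_forall fun h _ h3 h4 => absurd ⟨h3, h4⟩ hx
  rw [Measure.ae_ae_comm hms] at h1
  set N := {x : EuclideanSpace ℝ (Fin n) | (∀ j, 0 < x j) ∧ x ∈ M ∧ x ∉ boxRep M}
  have hN : volume N = 0 := by
    refine le_antisymm (le_of_forall_gt_imp_ge_of_dense fun ε hε => ?_) bot_le
    have h2 := (tendsto_volume_symmDiff_translate hM hfin).eventually (gt_mem_nhds hε)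
    obtain ⟨r, hr, h3⟩ := Metric.eventually_nhds_iff_ball.1 h2
    have hpos : volume (Metric.ball (0 : EuclideanSpace ℝ (Fin n)) r ∩
        {x | ∀ j, 0 < x j}) ≠ 0 := by
      refine (IsOpen.measure_pos volume (Metric.isOpen_ball.inter (isOpen_orthant n)) ?_).ne'
      set u : EuclideanSpace ℝ (Fin n) := WithLp.toLp 2 fun _ => 1
      have hc : Filter.Tendsto (fun t : ℝ => t • u) (nhdsWithin 0 (Set.Ioi 0)) (nhds 0) := by
        have : Filter.Tendsto (fun t : ℝ => t • u) (nhds 0) (nhds ((0 : ℝ) • u)) :=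
          (continuous_id.smul continuous_const).tendsto 0
        rw [zero_smul] at this
        exact this.mono_left nhdsWithin_le_nhds
      obtain ⟨t, ht1, ht2⟩ := ((hc.eventually (Metric.ball_mem_nhds 0 hr)).and
        self_mem_nhdsWithin).exists
      refine ⟨t • u, ht1, fun j => ?_⟩
      change 0 < t * 1
      rw [mul_one]
      exact ht2
    obtain ⟨h, hh1, hh2⟩ : ∃ h ∈ Metric.ball (0 : EuclideanSpace ℝ (Fin n)) r ∩
        {x | ∀ j, 0 < x j}, ∀ᵐ x : EuclideanSpace ℝ (Fin n),
          (∀ j, 0 < h j) → (∀ j, 0 < x j) → x ∉ boxRep M → x + h ∉ M := by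
      by_contra hcon
      exact hpos (measure_mono_null (fun h hh h2 => hcon ⟨h, hh, h2⟩) (ae_iff.1 h1))
    refine le_trans ?_ (h3 h hh1.1).le
    refine measure_mono_ae ?_
    filter_upwards [hh2] with x hx hxN
    exact Or.inr ⟨hxN.2.1, hx hh1.2 hxN.1 hxN.2.2⟩
  rw [measure_eq_zero_iff_ae_notMem] at hN
  filter_upwards [hN] with x hx h2 h3
  by_contra h4
  exact hx ⟨h2, h3, h4⟩

theorem measurePreserving_signFlip {n : ℕ} (S : Finset (Fin n)) :
    MeasurePreserving (signFlip S (n := n)) volume volume := by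
  induction S using Finset.induction_on with
  | empty =>
    have : signFlip (∅ : Finset (Fin n)) = id := funext signFlip_empty
    rw [this]
    exact MeasurePreserving.id _
  | insert i S hi ih =>
    have : signFlip (insert i S) = coordReflection i ∘ signFlip S :=
      funext (signFlip_insert hi)
    rw [this]
    exact (measurePreserving_coordReflection i).comp ih

theorem ae_signFlip_mem_iff {n : ℕ} {M : Set (EuclideanSpace ℝ (Fin n))}
    (hS : ∀ i : Fin n, ∀ᵐ x, coordReflection i x ∈ M ↔ x ∈ M) (S : Finset (Fin n)) :
    ∀ᵐ x, signFlip S x ∈ M ↔ x ∈ M := by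
  induction S using Finset.induction_on with
  | empty => simp
  | insert i S hi ih =>
    filter_upwards [ih, (measurePreserving_signFlip S).quasiMeasurePreserving.ae (hS i)]
      with x h1 h2
    rw [signFlip_insert hi, h2, h1]

theorem ae_eq_boxRep {n : ℕ} {M : Set (EuclideanSpace ℝ (Fin n))} (hM : MeasurableSet M)
    (hfin : volume M ≠ ∞) (hS : ∀ i : Fin n, ∀ᵐ x, coordReflection i x ∈ M ↔ x ∈ M)
    (hT : ∀ i : Fin n, ∀ t : ℝ, 0 < t →
      ∀ᵐ x, 0 < x i → x + EuclideanSpace.single i t ∈ M → x ∈ M) :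
    M =ᵐ[volume] boxRep M := by
  have hQ : ∀ᵐ x : EuclideanSpace ℝ (Fin n), (∀ j, 0 < x j) → (x ∈ M ↔ x ∈ boxRep M) := by
    filter_upwards [ae_mem_of_mem_boxRep hM hT, ae_mem_boxRep_of_mem hM hfin] with x h1 h2 h3
    exact ⟨h2 h3, h1 h3⟩
  have h1 : ∀ᵐ x : EuclideanSpace ℝ (Fin n), ∀ S : Finset (Fin n), signFlip S x ∈ M ↔ x ∈ M :=
    ae_all_iff.2 fun S => ae_signFlip_mem_iff hS S
  have h2 : ∀ᵐ x : EuclideanSpace ℝ (Fin n), ∀ S : Finset (Fin n),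
      (∀ j, 0 < signFlip S x j) → (signFlip S x ∈ M ↔ signFlip S x ∈ boxRep M) :=
    ae_all_iff.2 fun S => (measurePreserving_signFlip S).quasiMeasurePreserving.ae hQ
  have h3 : ∀ᵐ x : EuclideanSpace ℝ (Fin n), ∀ j, x j ≠ 0 := ae_all_iff.2 fun j => ae_coord_ne j 0
  filter_upwards [h1, h2, h3] with x hx1 hx2 hx3
  apply propext
  classical
  -- Flipping the negative coordinates carries x into the open positive orthant, where the two sets
  -- have already been compared.
  set S : Finset (Fin n) := Finset.univ.filter fun j => x j < 0 with hSdef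
  have hpos : ∀ j, 0 < signFlip S x j := fun j => by
    rw [signFlip_apply]
    by_cases hj : x j < 0
    · simp [hSdef, hj]
    · simp only [hSdef, Finset.mem_filter, Finset.mem_univ, true_and, hj, if_false]
      exact lt_of_le_of_ne (not_lt.1 hj) (hx3 j).symm
  change x ∈ M ↔ x ∈ boxRep M
  rw [← hx1 S, hx2 S hpos]
  refine ⟨fun h => ?_, fun h => (isBoxMonotone_boxRep M).isUnconditional.signFlip_mem S h⟩
  refine isBoxMonotone_boxRep M _ h x fun j => ?_
  rw [signFlip_apply]
  split_ifs <;> simp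

/-- Minimizers are, up to translation and null sets, unconditional star bodies. -/
theorem IsMinimizer.exists_isStarBody {n : ℕ} {s : ℝ} (hs0 : 0 < s) (hs1 : s < 1)
    {K M : Set (EuclideanSpace ℝ (Fin n))} (hK : IsConvexBody K) (hKu : IsUnconditional K)
    (hKs : StrictConvex ℝ K) (hM : IsMinimizer s K M) :
    ∃ L, IsStarBody L ∧ IsUnconditional L ∧ EquivTranslate M L := by
  obtain ⟨c, hc⟩ := exists_medians hM.isBounded
  have hM' := hM.preimage_add c
  have hS := fun i => hM'.ae_symmetric hs0 hs1 hK hKu hKs i (hc i)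
  have hT := fun i t ht => hM'.ae_monotone hs0 hs1 hK hKu hKs i (hS i) (t := t) ht
  have hae := ae_eq_boxRep hM'.measurableSet hM'.volume_ne_top hS hT
  have hne : (boxRep ((fun x => c + x) ⁻¹' M)).Nonempty := by
    refine nonempty_of_measure_ne_zero (μ := volume) ?_
    rw [← measure_congr hae]
    exact hM'.volume_pos.ne'
  have hbm := isBoxMonotone_boxRep ((fun x => c + x) ⁻¹' M)
  refine ⟨_, hbm.isStarBody (isOpen_boxRep _) (isBounded_boxRep hM'.isBounded) hne,
    hbm.isUnconditional, c, ?_⟩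
  rw [image_add_eq_preimage]
  have := (measurePreserving_add_left volume (-c)).quasiMeasurePreserving.preimage_ae_eq hae
  rwa [← Set.preimage_comp, show (fun x => c + x) ∘ (fun x => -c + x) = id by
    funext x; simp, Set.preimage_id] at this


/-! ### Dilates of star-shaped optimal sets -/

/-- Bounded star-shaped sets which attain equality in the isoperimetric inequality. -/
structure IsOptimalShape {n : ℕ} (s : ℝ) (K L : Set (EuclideanSpace ℝ (Fin n))) : Prop where
  nullMeasurableSet : NullMeasurableSet L volume
  isBounded : Bornology.IsBounded L
  starConvex : StarConvex ℝ 0 L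
  volume_ne_zero : volume L ≠ 0
  eq_isoConst : fracPerimeter s K L = isoConst s K * volume L ^ (((n : ℝ) - s) / n)

theorem EquivTranslate.exists_ae_eq_preimage {n : ℕ} {M L : Set (EuclideanSpace ℝ (Fin n))}
    (h : EquivTranslate M L) :
    ∃ c : EuclideanSpace ℝ (Fin n), L =ᵐ[volume] (fun x => c + x) ⁻¹' M := by
  obtain ⟨c, hc⟩ := h
  refine ⟨c, ?_⟩
  have := (measurePreserving_add_left volume c).quasiMeasurePreserving.preimage_ae_eq hc
  rw [Set.preimage_image_eq _ (add_right_injective c)] at this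
  exact this.symm

theorem IsMinimizer.isOptimalShape {n : ℕ} {s : ℝ} {K M L : Set (EuclideanSpace ℝ (Fin n))}
    (hM : IsMinimizer s K M) (hL : IsStarBody L) (hML : EquivTranslate M L) :
    IsOptimalShape s K L := by
  obtain ⟨c, hc⟩ := hML.exists_ae_eq_preimage
  have hM' := hM.preimage_add c
  exact {
    nullMeasurableSet := hM'.measurableSet.nullMeasurableSet.congr hc.symm
    isBounded := hL.isBounded
    starConvex := hL.starConvex
    volume_ne_zero := by rw [measure_congr hc]; exact hM'.volume_pos.ne'
    eq_isoConst := by rw [measure_congr hc, fracPerimeter_congr s K hc, hM'.eq_isoConst] }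

theorem volume_smul {n : ℕ} {r : ℝ} (hr : 0 ≤ r) (L : Set (EuclideanSpace ℝ (Fin n))) :
    volume (r • L) = ENNReal.ofReal (r ^ n) * volume L := by
  rw [Measure.addHaar_smul_of_nonneg volume hr, finrank_euclideanSpace, Fintype.card_fin]

theorem smul_subset_smul_of_starConvex {n : ℕ} {L : Set (EuclideanSpace ℝ (Fin n))}
    (hL : StarConvex ℝ 0 L) {r r' : ℝ} (hr : 0 ≤ r) (hrr' : r ≤ r') : r • L ⊆ r' • L := by
  rintro _ ⟨x, hx, rfl⟩
  rcases eq_or_lt_of_le (hr.trans hrr') with h | h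
  · have : r = r' := le_antisymm hrr' (h ▸ hr)
    rw [← this]
    exact Set.smul_mem_smul_set hx
  · refine ⟨(r / r') • x, hL.smul_mem hx (by positivity) ((div_le_one h).2 hrr'), ?_⟩
    simp only [smul_smul, mul_div_cancel₀ _ h.ne']

theorem existsUnique_volume_smul_eq {n : ℕ} (hn : 1 ≤ n) {L : Set (EuclideanSpace ℝ (Fin n))}
    (h0 : volume L ≠ 0) (hfin : volume L ≠ ∞) {m : ℝ≥0∞} (hm : m ≠ ∞) :
    ∃! r : ℝ, 0 ≤ r ∧ volume (r • L) = m := by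
  have hn0 : n ≠ 0 := by omega
  set q := (m / volume L).toReal with hq
  have hq0 : 0 ≤ q := ENNReal.toReal_nonneg
  have hqm : ENNReal.ofReal q * volume L = m := by
    rw [hq, ENNReal.ofReal_toReal (ENNReal.div_ne_top hm h0), ENNReal.div_mul_cancel h0 hfin]
  refine ⟨q ^ ((n : ℝ)⁻¹), ⟨by positivity, ?_⟩, ?_⟩
  · rw [volume_smul (by positivity), Real.rpow_inv_natCast_pow hq0 hn0, hqm]
  · rintro r ⟨hr0, hr⟩
    rw [volume_smul hr0, ← hqm, ENNReal.mul_left_inj h0 hfin,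
      ENNReal.ofReal_eq_ofReal_iff (by positivity) hq0] at hr
    rw [← hr, Real.pow_rpow_inv_natCast hr0 hn0]

theorem symmSet_eq_smul {n : ℕ} (hn : 1 ≤ n) {L E : Set (EuclideanSpace ℝ (Fin n))}
    (h0 : volume L ≠ 0) (hfin : volume L ≠ ∞) (hE : volume E ≠ ∞) {r : ℝ} (hr : 0 ≤ r)
    (h : volume (r • L) = volume E) : symmSet L E = r • L := by
  rw [symmSet, if_neg hE]
  ext x
  constructor
  · rintro ⟨r', hr', h', hx⟩
    rwa [(existsUnique_volume_smul_eq hn h0 hfin hE).unique ⟨hr, h⟩ ⟨hr', h'⟩]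
  · exact fun hx => ⟨r, hr, h, hx⟩

theorem IsOptimalShape.volume_ne_top {n : ℕ} {s : ℝ} {K L : Set (EuclideanSpace ℝ (Fin n))}
    (hL : IsOptimalShape s K L) : volume L ≠ ∞ := hL.isBounded.measure_lt_top.ne

theorem IsOptimalShape.exists_symmSet_eq {n : ℕ} (hn : 1 ≤ n) {s : ℝ}
    {K L : Set (EuclideanSpace ℝ (Fin n))} (hL : IsOptimalShape s K L)
    {E : Set (EuclideanSpace ℝ (Fin n))} (hE : volume E ≠ ∞) :
    ∃ r : ℝ, 0 ≤ r ∧ volume (r • L) = volume E ∧ symmSet L E = r • L := by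
  obtain ⟨r, ⟨hr0, hr⟩, -⟩ :=
    existsUnique_volume_smul_eq hn hL.volume_ne_zero hL.volume_ne_top hE
  exact ⟨r, hr0, hr, symmSet_eq_smul hn hL.volume_ne_zero hL.volume_ne_top hE hr0 hr⟩

theorem IsOptimalShape.nullMeasurableSet_symmSet {n : ℕ} (hn : 1 ≤ n) {s : ℝ}
    {K L : Set (EuclideanSpace ℝ (Fin n))} (hL : IsOptimalShape s K L)
    {E : Set (EuclideanSpace ℝ (Fin n))} (hE : volume E ≠ ∞) :
    NullMeasurableSet (symmSet L E) volume := by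
  obtain ⟨r, -, -, h⟩ := hL.exists_symmSet_eq hn hE
  rw [h]
  exact Measure.NullMeasurableSet.const_smul hL.nullMeasurableSet r

theorem IsOptimalShape.volume_symmSet {n : ℕ} (hn : 1 ≤ n) {s : ℝ}
    {K L : Set (EuclideanSpace ℝ (Fin n))} (hL : IsOptimalShape s K L)
    {E : Set (EuclideanSpace ℝ (Fin n))} (hE : volume E ≠ ∞) :
    volume (symmSet L E) = volume E := by
  obtain ⟨r, -, h1, h⟩ := hL.exists_symmSet_eq hn hE
  rw [h, h1]

/-- Dilates of a star-shaped set are nested, and their order is that of their volumes. -/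
theorem IsOptimalShape.symmSet_mono {n : ℕ} (hn : 1 ≤ n) {s : ℝ}
    {K L : Set (EuclideanSpace ℝ (Fin n))} (hL : IsOptimalShape s K L)
    {E F : Set (EuclideanSpace ℝ (Fin n))} (hF : volume F ≠ ∞) (hEF : volume E ≤ volume F) :
    symmSet L E ⊆ symmSet L F := by
  obtain ⟨r, hr0, h1, h⟩ := hL.exists_symmSet_eq hn (ne_top_of_le_ne_top hF hEF)
  obtain ⟨r', hr0', h1', h'⟩ := hL.exists_symmSet_eq hn hF
  rw [h, h']
  refine smul_subset_smul_of_starConvex hL.starConvex hr0 ?_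
  rw [← h1, ← h1', volume_smul hr0, volume_smul hr0',
    ENNReal.mul_le_mul_iff_left hL.volume_ne_zero hL.volume_ne_top,
    ENNReal.ofReal_le_ofReal_iff (by positivity)] at hEF
  exact (pow_le_pow_iff_left₀ hr0 hr0' (by omega)).1 hEF

/-- Perimeter and the power of the volume both scale by r^(n-s), so equality passes from L to its
dilates; r = 0 gives a null set and is treated apart. -/
theorem IsOptimalShape.fracPerimeter_symmSet {n : ℕ} (hn : 1 ≤ n) {s : ℝ} (hs1 : s < 1)
    {K L : Set (EuclideanSpace ℝ (Fin n))} (hL : IsOptimalShape s K L)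
    {E : Set (EuclideanSpace ℝ (Fin n))} (hE : volume E ≠ ∞) :
    fracPerimeter s K (symmSet L E) = isoConst s K * volume E ^ (((n : ℝ) - s) / n) := by
  obtain ⟨r, hr0, h1, h⟩ := hL.exists_symmSet_eq hn hE
  rw [h, ← h1]
  have hα := exponent_pos hn hs1
  rcases eq_or_lt_of_le hr0 with h0 | h0
  · have hv : volume (r • L) = 0 := by
      rw [volume_smul hr0, ← h0, zero_pow (by omega), ENNReal.ofReal_zero, zero_mul]
    rw [fracPerimeter_congr s K (ae_eq_empty.2 hv), hv, ENNReal.zero_rpow_of_pos hα, mul_zero]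
    simp [fracPerimeter]
  · have hnr : (n : ℝ) ≠ 0 := by
      have : (1 : ℝ) ≤ n := by exact_mod_cast hn
      linarith
    rw [fracPerimeter_smul h0, hL.eq_isoConst, volume_smul hr0,
      ENNReal.mul_rpow_of_nonneg _ _ hα.le, ENNReal.ofReal_rpow_of_pos (by positivity),
      ← Real.rpow_natCast, ← Real.rpow_mul hr0, mul_div_cancel₀ _ hnr, mul_left_comm]

/-! ### Superlevel sets of the rearrangement -/

theorem lt_symmFun_iff {n : ℕ} {L : Set (EuclideanSpace ℝ (Fin n))}
    {f : EuclideanSpace ℝ (Fin n) → ℝ} {x : EuclideanSpace ℝ (Fin n)} {t : ℝ} (ht : 0 ≤ t) :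
    ENNReal.ofReal t < symmFun L f x ↔ ∃ τ : ℝ, t < τ ∧ x ∈ symmSet L {y | τ < |f y|} := by
  rw [symmFun, lt_sSup_iff]
  constructor
  · rintro ⟨_, ⟨τ, h1, h2, rfl⟩, h3⟩
    exact ⟨τ, (ENNReal.ofReal_lt_ofReal_iff h1).1 h3, h2⟩
  · rintro ⟨τ, h1, h2⟩
    exact ⟨_, ⟨τ, ht.trans_lt h1, h2, rfl⟩, (ENNReal.ofReal_lt_ofReal_iff (ht.trans_lt h1)).2 h1⟩

theorem volume_superlevel_ne_top {n : ℕ} {f : EuclideanSpace ℝ (Fin n) → ℝ}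
    (hf : Integrable f volume) {t : ℝ} (ht : 0 < t) : volume {y | t < |f y|} ≠ ∞ :=
  (hf.measure_norm_gt_lt_top ht).ne

theorem IsOptimalShape.antitone_symmSet {n : ℕ} (hn : 1 ≤ n) {s : ℝ}
    {K L : Set (EuclideanSpace ℝ (Fin n))} (hL : IsOptimalShape s K L)
    {f : EuclideanSpace ℝ (Fin n) → ℝ} (hf : Integrable f volume) {t t' : ℝ} (ht : 0 < t)
    (htt' : t ≤ t') : symmSet L {y | t' < |f y|} ⊆ symmSet L {y | t < |f y|} :=
  hL.symmSet_mono hn (volume_superlevel_ne_top hf ht)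
    (measure_mono fun _ hy => htt'.trans_lt hy)

theorem IsOptimalShape.superlevel_symmFun_eq {n : ℕ} (hn : 1 ≤ n) {s : ℝ}
    {K L : Set (EuclideanSpace ℝ (Fin n))} (hL : IsOptimalShape s K L)
    {f : EuclideanSpace ℝ (Fin n) → ℝ} (hf : Integrable f volume) {t : ℝ} (ht : 0 ≤ t) :
    {x | ENNReal.ofReal t < symmFun L f x} =
      ⋃ k : ℕ, symmSet L {y | t + 1 / ((k : ℝ) + 1) < |f y|} := by
  ext x
  rw [Set.mem_iUnion]
  change ENNReal.ofReal t < symmFun L f x ↔ _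
  rw [lt_symmFun_iff ht]
  constructor
  · rintro ⟨τ, h1, h2⟩
    obtain ⟨k, hk⟩ := exists_nat_one_div_lt (sub_pos.2 h1)
    exact ⟨k, hL.antitone_symmSet hn hf (by positivity) (by linarith) h2⟩
  · rintro ⟨k, hk⟩
    exact ⟨_, lt_add_of_pos_right _ (by positivity), hk⟩

theorem IsOptimalShape.nullMeasurableSet_superlevel {n : ℕ} (hn : 1 ≤ n) {s : ℝ}
    {K L : Set (EuclideanSpace ℝ (Fin n))} (hL : IsOptimalShape s K L)
    {f : EuclideanSpace ℝ (Fin n) → ℝ} (hf : Integrable f volume) {t : ℝ} (ht : 0 ≤ t) :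
    NullMeasurableSet {x | ENNReal.ofReal t < symmFun L f x} volume := by
  rw [hL.superlevel_symmFun_eq hn hf ht]
  exact NullMeasurableSet.iUnion fun k =>
    hL.nullMeasurableSet_symmSet hn (volume_superlevel_ne_top hf (by positivity))

/-- The superlevel set is the union of the symmetrizations at levels above t. It lies inside the one
at level t and has the same volume by continuity from below. Equality holds only up to null sets, as
boundary points of the dilate may be missing. -/
theorem IsOptimalShape.superlevel_ae_eq {n : ℕ} (hn : 1 ≤ n) {s : ℝ}
    {K L : Set (EuclideanSpace ℝ (Fin n))} (hL : IsOptimalShape s K L)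
    {f : EuclideanSpace ℝ (Fin n) → ℝ} (hf : Integrable f volume) {t : ℝ} (ht : 0 < t) :
    {x | ENNReal.ofReal t < symmFun L f x} =ᵐ[volume] symmSet L {y | t < |f y|} := by
  have hfin := volume_superlevel_ne_top hf ht
  have hanti : ∀ {a b : ℕ}, a ≤ b → t + 1 / ((b : ℝ) + 1) ≤ t + 1 / ((a : ℝ) + 1) := by
    intro a b hab
    gcongr
  have hU : {y | t < |f y|} = ⋃ k : ℕ, {y | t + 1 / ((k : ℝ) + 1) < |f y|} := by
    ext y
    rw [Set.mem_iUnion]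
    constructor
    · intro (hy : t < |f y|)
      obtain ⟨k, hk⟩ := exists_nat_one_div_lt (sub_pos.2 hy)
      exact ⟨k, show t + 1 / ((k : ℝ) + 1) < |f y| by linarith⟩
    · rintro ⟨k, hk⟩
      exact (lt_add_of_pos_right t (by positivity)).trans hk
  have hmono1 : Monotone fun k : ℕ => {y | t + 1 / ((k : ℝ) + 1) < |f y|} :=
    fun a b hab y hy => (hanti hab).trans_lt hy
  have hmono2 : Monotone fun k : ℕ => symmSet L {y | t + 1 / ((k : ℝ) + 1) < |f y|} :=
    fun a b hab => hL.antitone_symmSet hn hf (by positivity) (hanti hab)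
  have hvol : volume {x | ENNReal.ofReal t < symmFun L f x} = volume {y | t < |f y|} := by
    rw [hL.superlevel_symmFun_eq hn hf ht.le, hmono2.measure_iUnion, hU, hmono1.measure_iUnion]
    exact iSup_congr fun k =>
      hL.volume_symmSet hn (volume_superlevel_ne_top hf (by positivity))
  refine ae_eq_of_subset_of_measure_ge ?_ ?_ (hL.nullMeasurableSet_superlevel hn hf ht.le) ?_
  · rw [hL.superlevel_symmFun_eq hn hf ht.le]
    exact Set.iUnion_subset fun k =>
      hL.antitone_symmSet hn hf ht (le_add_of_nonneg_right (by positivity))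
  · rw [hvol, hL.volume_symmSet hn hfin]
  · rw [hL.volume_symmSet hn hfin]
    exact hfin

theorem IsOptimalShape.aemeasurable_symmFun {n : ℕ} (hn : 1 ≤ n) {s : ℝ}
    {K L : Set (EuclideanSpace ℝ (Fin n))} (hL : IsOptimalShape s K L)
    {f : EuclideanSpace ℝ (Fin n) → ℝ} (hf : Integrable f volume) :
    AEMeasurable (symmFun L f) volume := by
  refine NullMeasurable.aemeasurable ?_
  have h : @Measurable (NullMeasurableSpace (EuclideanSpace ℝ (Fin n)) volume) ℝ≥0∞ _ _
      (symmFun L f) := by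
    refine measurable_of_Ioi fun a => ?_
    rcases eq_or_ne a ∞ with rfl | ha
    · rw [Set.Ioi_top]
      exact MeasurableSet.empty
    · have := hL.nullMeasurableSet_superlevel hn hf (t := a.toReal) ENNReal.toReal_nonneg
      rw [ENNReal.ofReal_toReal ha] at this
      exact this
  exact fun S hS => h hS

/-- An infinite value at x ≠ 0 would put x in the dilate at every level, forcing its radius to be at
least ‖x‖/R. The sets {|f| > t} would then have volume bounded below for all t, against
integrability. At the origin nothing prevents the value ∞. -/
theorem IsOptimalShape.symmFun_lt_top {n : ℕ} (hn : 1 ≤ n) {s : ℝ}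
    {K L : Set (EuclideanSpace ℝ (Fin n))} (hL : IsOptimalShape s K L)
    {f : EuclideanSpace ℝ (Fin n) → ℝ} (hf : Integrable f volume)
    {x : EuclideanSpace ℝ (Fin n)} (hx : x ≠ 0) : symmFun L f x < ∞ := by
  by_contra htop
  rw [not_lt, top_le_iff] at htop
  obtain ⟨R, hR0, hR⟩ := hL.isBounded.subset_closedBall_lt 0 0
  have hx0 := norm_pos_iff.2 hx
  set c := ENNReal.ofReal ((‖x‖ / R) ^ n) * volume L with hc
  have hc0 : c ≠ 0 := mul_ne_zero (ENNReal.ofReal_pos.2 (by positivity)).ne' hL.volume_ne_zero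
  have hlow : ∀ t : ℝ, 0 < t → c ≤ volume {y | t < |f y|} := by
    intro t ht
    obtain ⟨τ, h1, h2⟩ := (lt_symmFun_iff (L := L) (f := f) (x := x) ht.le).1
      (by rw [htop]; exact ENNReal.ofReal_lt_top)
    replace h2 := hL.antitone_symmSet hn hf ht h1.le h2
    obtain ⟨r, hr0, h3, h4⟩ := hL.exists_symmSet_eq hn (volume_superlevel_ne_top hf ht)
    rw [h4] at h2
    obtain ⟨y, hy, rfl⟩ := h2
    have h5 := hR hy
    rw [mem_closedBall_zero_iff] at h5
    rw [← h3, volume_smul hr0, hc]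
    gcongr
    rw [div_le_iff₀ hR0]
    simp only [norm_smul, Real.norm_of_nonneg hr0]
    gcongr
  have hint : ∫⁻ y, ‖f y‖ₑ ≠ ∞ := hf.2.ne
  -- At this level Markov's inequality is violated.
  obtain ⟨k, hk⟩ := ENNReal.exists_nat_mul_gt hc0 hint
  refine absurd hk (not_lt.2 ?_)
  rcases Nat.eq_zero_or_pos k with rfl | hkpos
  · simp
  · refine le_trans ?_ (mul_meas_ge_le_lintegral₀ hf.1.aemeasurable.enorm (k : ℝ≥0∞))
    gcongr
    refine (hlow k (by exact_mod_cast hkpos)).trans (measure_mono fun y hy => ?_)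
    have hy' : (k : ℝ) < |f y| := hy
    change (k : ℝ≥0∞) ≤ ‖f y‖ₑ
    rw [Real.enorm_eq_ofReal_abs, ← ENNReal.ofReal_natCast]
    exact ENNReal.ofReal_le_ofReal hy'.le

/-! ### The coarea formula -/

theorem interaction_comm {n : ℕ} (s : ℝ) {K : Set (EuclideanSpace ℝ (Fin n))}
    (hK : IsConvexBody K) (hKu : IsUnconditional K) (A B : Set (EuclideanSpace ℝ (Fin n))) :
    interaction s K A B = interaction s K B A := by
  rw [interaction, lintegral_lintegral_swap (measurable_kernel_sub s hK hKu).aemeasurable,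
    interaction]
  simp_rw [kernel_sub_comm s hKu]

theorem ofReal_abs_sub_eq_lintegral {a b : ℝ} (ha : 0 ≤ a) (hb : 0 ≤ b) :
    ENNReal.ofReal |a - b| = ∫⁻ t in Set.Ioi (0 : ℝ),
      ((Set.Ico b a).indicator 1 t + (Set.Ico a b).indicator 1 t) := by
  have h : ∀ c d : ℝ, 0 ≤ c → ∫⁻ t in Set.Ioi (0 : ℝ), (Set.Ico c d).indicator 1 t =
      ENNReal.ofReal (d - c) := fun c d hc => by
    rw [lintegral_indicator_one measurableSet_Ico, Measure.restrict_congr_set Ioi_ae_eq_Ici,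
      Measure.restrict_apply measurableSet_Ico, Set.inter_eq_left.2, Real.volume_Ico]
    exact fun t ht => hc.trans ht.1
  rw [lintegral_add_left (measurable_one.indicator measurableSet_Ico), h b a hb, h a b ha]
  rcases le_total a b with hab | hab
  · rw [ENNReal.ofReal_of_nonpos (sub_nonpos.2 hab), zero_add, abs_sub_comm,
      abs_of_nonneg (sub_nonneg.2 hab)]
  · rw [ENNReal.ofReal_of_nonpos (sub_nonpos.2 hab), add_zero, abs_of_nonneg (sub_nonneg.2 hab)]

theorem fracSeminorm_eq_lintegral_kernel {n : ℕ} (s : ℝ) (K : Set (EuclideanSpace ℝ (Fin n)))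
    (f : EuclideanSpace ℝ (Fin n) → ℝ) :
    fracSeminorm s K f = ∫⁻ x, ∫⁻ y, ENNReal.ofReal |f x - f y| * kernel s K (x - y) := by
  refine lintegral_congr fun x => lintegral_congr fun y => ?_
  rw [kernel, ← ENNReal.ofReal_mul (abs_nonneg _), mul_one_div]

/-- Write |g x - g y| as the measure of the levels t separating g x from g y and apply Tonelli. Each
level contributes the pairs crossing in either direction, hence twice the perimeter by symmetry of
the kernel. -/
theorem fracSeminorm_eq_lintegral_fracPerimeter {n : ℕ} (s : ℝ)
    {K : Set (EuclideanSpace ℝ (Fin n))} (hK : IsConvexBody K) (hKu : IsUnconditional K)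
    {g : EuclideanSpace ℝ (Fin n) → ℝ} (hg : Measurable g) (hg0 : ∀ x, 0 ≤ g x) :
    fracSeminorm s K g =
      ∫⁻ t in Set.Ioi (0 : ℝ), (fracPerimeter s K {x | t < g x} +
        fracPerimeter s K {x | t < g x}) := by
  have hk := measurable_kernel_sub s hK hKu
  have hS : ∀ u v : EuclideanSpace ℝ (Fin n) × EuclideanSpace ℝ (Fin n) → ℝ, Measurable u →
      Measurable v → Measurable fun q : (EuclideanSpace ℝ (Fin n) × EuclideanSpace ℝ (Fin n)) × ℝ =>
        ((Set.Ico (v q.1) (u q.1)).indicator 1 q.2 : ℝ≥0∞) := by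
    intro u v hu hv
    have : MeasurableSet {q : (EuclideanSpace ℝ (Fin n) × EuclideanSpace ℝ (Fin n)) × ℝ |
        v q.1 ≤ q.2 ∧ q.2 < u q.1} :=
      (measurableSet_le (hv.comp measurable_fst) measurable_snd).inter
        (measurableSet_lt measurable_snd (hu.comp measurable_fst))
    exact measurable_one.indicator this
  have hg1 : Measurable fun p : EuclideanSpace ℝ (Fin n) × EuclideanSpace ℝ (Fin n) => g p.1 :=
    hg.comp measurable_fst
  have hg2 : Measurable fun p : EuclideanSpace ℝ (Fin n) × EuclideanSpace ℝ (Fin n) => g p.2 :=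
    hg.comp measurable_snd
  have hm : Measurable fun q : (EuclideanSpace ℝ (Fin n) × EuclideanSpace ℝ (Fin n)) × ℝ =>
      (((Set.Ico (g q.1.2) (g q.1.1)).indicator 1 q.2 : ℝ≥0∞) +
        (Set.Ico (g q.1.1) (g q.1.2)).indicator 1 q.2) * kernel s K (q.1.1 - q.1.2) :=
    ((hS _ _ hg1 hg2).add (hS _ _ hg2 hg1)).mul (hk.comp measurable_fst)
  have hm0 : Measurable fun p : EuclideanSpace ℝ (Fin n) × EuclideanSpace ℝ (Fin n) =>
      ENNReal.ofReal |g p.1 - g p.2| * kernel s K (p.1 - p.2) := by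
    have : Measurable fun p : EuclideanSpace ℝ (Fin n) × EuclideanSpace ℝ (Fin n) =>
      |g p.1 - g p.2| := (hg1.sub hg2).abs
    exact this.ennreal_ofReal.mul hk
  rw [fracSeminorm_eq_lintegral_kernel]
  calc ∫⁻ x, ∫⁻ y, ENNReal.ofReal |g x - g y| * kernel s K (x - y)
      = ∫⁻ p : EuclideanSpace ℝ (Fin n) × EuclideanSpace ℝ (Fin n),
          ENNReal.ofReal |g p.1 - g p.2| * kernel s K (p.1 - p.2)
          ∂(volume.prod volume) := by
        rw [lintegral_prod _ hm0.aemeasurable]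
    _ = ∫⁻ p : EuclideanSpace ℝ (Fin n) × EuclideanSpace ℝ (Fin n), (∫⁻ t in Set.Ioi (0 : ℝ),
          (((Set.Ico (g p.2) (g p.1)).indicator 1 t : ℝ≥0∞) +
            (Set.Ico (g p.1) (g p.2)).indicator 1 t) * kernel s K (p.1 - p.2))
          ∂(volume.prod volume) := by
        refine lintegral_congr fun p => ?_
        rw [lintegral_mul_const' _ _ (kernel_lt_top _).ne,
          ofReal_abs_sub_eq_lintegral (hg0 _) (hg0 _)]
    _ = ∫⁻ t in Set.Ioi (0 : ℝ), ∫⁻ p : EuclideanSpace ℝ (Fin n) × EuclideanSpace ℝ (Fin n),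
          (((Set.Ico (g p.2) (g p.1)).indicator 1 t : ℝ≥0∞) +
            (Set.Ico (g p.1) (g p.2)).indicator 1 t) * kernel s K (p.1 - p.2)
          ∂(volume.prod volume) := lintegral_lintegral_swap hm.aemeasurable
    _ = _ := by
        refine lintegral_congr fun t => ?_
        have hE : MeasurableSet {x | t < g x} := measurableSet_lt measurable_const hg
        have he := measurable_one (α := ℝ≥0∞).indicator hE
        have he' := measurable_one (α := ℝ≥0∞).indicator hE.compl
        have hpt : ∀ p : EuclideanSpace ℝ (Fin n) × EuclideanSpace ℝ (Fin n),
            (((Set.Ico (g p.2) (g p.1)).indicator 1 t : ℝ≥0∞) +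
              (Set.Ico (g p.1) (g p.2)).indicator 1 t) * kernel s K (p.1 - p.2) =
            {x | t < g x}.indicator 1 p.1 * {x | t < g x}ᶜ.indicator 1 p.2 *
                kernel s K (p.1 - p.2) +
              {x | t < g x}ᶜ.indicator 1 p.1 * {x | t < g x}.indicator 1 p.2 *
                kernel s K (p.1 - p.2) := by
          intro p
          rw [add_mul]
          by_cases h1 : t < g p.1 <;> by_cases h2 : t < g p.2 <;>
            simp [Set.indicator, h1, h2, not_le.2, not_lt.1]
        have hm1 : ∀ A B : Set (EuclideanSpace ℝ (Fin n)), MeasurableSet A → MeasurableSet B →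
            Measurable fun p : EuclideanSpace ℝ (Fin n) × EuclideanSpace ℝ (Fin n) =>
              (A.indicator 1 p.1 : ℝ≥0∞) * B.indicator 1 p.2 * kernel s K (p.1 - p.2) :=
          fun A B hA hB => (((measurable_one.indicator hA).comp measurable_fst).mul
            ((measurable_one.indicator hB).comp measurable_snd)).mul hk
        simp_rw [hpt]
        rw [lintegral_add_left (hm1 _ _ hE hE.compl),
          lintegral_prod _ (hm1 _ _ hE hE.compl).aemeasurable,
          lintegral_prod _ (hm1 _ _ hE.compl hE).aemeasurable,
          ← interaction_eq_lintegral_indicator s K hE hE.compl,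
          ← interaction_eq_lintegral_indicator s K hE.compl hE,
          interaction_comm s hK hKu {x | t < g x}ᶜ]
        rfl

theorem fracSeminorm_congr {n : ℕ} (s : ℝ) (K : Set (EuclideanSpace ℝ (Fin n)))
    {f g : EuclideanSpace ℝ (Fin n) → ℝ} (h : f =ᵐ[volume] g) :
    fracSeminorm s K f = fracSeminorm s K g := by
  refine lintegral_congr_ae ?_
  filter_upwards [h] with x hx
  refine lintegral_congr_ae ?_
  filter_upwards [h] with y hy
  rw [hx, hy]

theorem fracSeminorm_abs_le {n : ℕ} (s : ℝ) (K : Set (EuclideanSpace ℝ (Fin n)))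
    (f : EuclideanSpace ℝ (Fin n) → ℝ) :
    fracSeminorm s K (fun x => |f x|) ≤ fracSeminorm s K f := by
  rw [fracSeminorm_eq_lintegral_kernel, fracSeminorm_eq_lintegral_kernel]
  refine lintegral_mono fun x => lintegral_mono fun y => ?_
  exact mul_le_mul_left (ENNReal.ofReal_le_ofReal (abs_abs_sub_abs_le (f x) (f y))) _

/-- The rearrangement does not increase the fractional seminorm. -/
theorem IsOptimalShape.fracSeminorm_symmFun_le {n : ℕ} (hn : 1 ≤ n) {s : ℝ} (hs0 : 0 < s)
    (hs1 : s < 1) {K L : Set (EuclideanSpace ℝ (Fin n))} (hK : IsConvexBody K)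
    (hKu : IsUnconditional K) (hL : IsOptimalShape s K L)
    {f : EuclideanSpace ℝ (Fin n) → ℝ} (hf : Integrable f volume) :
    fracSeminorm s K (fun x => (symmFun L f x).toReal) ≤ fracSeminorm s K f := by
  have : Nonempty (Fin n) := ⟨⟨0, hn⟩⟩
  have hfm := hf.1.aemeasurable
  have hm := hL.aemeasurable_symmFun hn hf
  -- The coarea formula is stated for measurable functions, so |f| and the rearrangement are
  -- replaced by measurable representatives.
  set g : EuclideanSpace ℝ (Fin n) → ℝ := fun x => |hfm.mk f x| with hgdef
  have hg : Measurable g := hfm.measurable_mk.abs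
  set h : EuclideanSpace ℝ (Fin n) → ℝ := fun x => (hm.mk (symmFun L f) x).toReal with hhdef
  have hh : Measurable h := hm.measurable_mk.ennreal_toReal
  have hfg : (fun x => |f x|) =ᵐ[volume] g := by
    filter_upwards [hfm.ae_eq_mk] with x hx
    rw [hgdef, hx]
  have hsh : (fun x => (symmFun L f x).toReal) =ᵐ[volume] h := by
    filter_upwards [hm.ae_eq_mk] with x hx
    rw [hhdef, hx]
  rw [fracSeminorm_congr s K hsh]
  refine le_trans ?_ (fracSeminorm_abs_le s K f)
  rw [fracSeminorm_congr s K hfg,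
    fracSeminorm_eq_lintegral_fracPerimeter s hK hKu hh fun x => ENNReal.toReal_nonneg,
    fracSeminorm_eq_lintegral_fracPerimeter s hK hKu hg fun x => abs_nonneg _]
  refine setLIntegral_mono' measurableSet_Ioi fun t (ht : 0 < t) => ?_
  have hfin := volume_superlevel_ne_top hf ht
  -- At the origin the rearrangement may be ∞, which `toReal` would send to 0.
  have hne : ∀ᵐ x : EuclideanSpace ℝ (Fin n), x ≠ 0 := by simp [ae_iff]
  have h1 : {x | t < h x} =ᵐ[volume] symmSet L {y | t < |f y|} := by
    refine Filter.EventuallyEq.trans ?_ (hL.superlevel_ae_eq hn hf ht)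
    filter_upwards [hsh, hne] with x hx hx0
    apply propext
    change t < h x ↔ ENNReal.ofReal t < symmFun L f x
    rw [← hx, ENNReal.ofReal_lt_iff_lt_toReal ht.le (hL.symmFun_lt_top hn hf hx0).ne]
  have h2 : {y | t < |f y|} =ᵐ[volume] {x | t < g x} := by
    filter_upwards [hfg] with x hx
    apply propext
    change t < |f x| ↔ t < g x
    rw [← hx]
  have h3 : fracPerimeter s K {x | t < h x} ≤ fracPerimeter s K {x | t < g x} := by
    rw [fracPerimeter_congr s K h1, hL.fracPerimeter_symmSet hn hs1 hfin, measure_congr h2]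
    refine isoConst_mul_le hn hs0 hs1 hK hKu (measurableSet_lt measurable_const hg) ?_
    rwa [← measure_congr h2]
  exact add_le_add h3 h3

/-! ### Independence of the representative -/

/-- Up to null sets L' is L shifted by d = c - c'. Both sets are symmetric in the i-th hyperplane,
so L' is carried into itself by the translation by -2 d_i e_i; being bounded and of positive volume,
it forces d_i = 0. -/
theorem ae_eq_of_equivTranslate {n : ℕ} {M L L' : Set (EuclideanSpace ℝ (Fin n))}
    (hLu : IsUnconditional L) (hL : EquivTranslate M L) (hLu' : IsUnconditional L')
    (hLb' : Bornology.IsBounded L') (h0 : volume L' ≠ 0) (hL' : EquivTranslate M L') :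
    L =ᵐ[volume] L' := by
  obtain ⟨c, hc⟩ := hL.exists_ae_eq_preimage
  obtain ⟨c', hc'⟩ := hL'.exists_ae_eq_preimage
  have h1 : ∀ᵐ x, x ∈ L ↔ x + (c - c') ∈ L' := by
    filter_upwards [hc, ae_add_right (c - c') hc'] with x hx hx'
    have hx1 : x ∈ L ↔ c + x ∈ M := iff_of_eq hx
    have hx2 : x + (c - c') ∈ L' ↔ c' + (x + (c - c')) ∈ M := iff_of_eq hx'
    rw [hx1, hx2, show c' + (x + (c - c')) = c + x by abel]
  have hd : c - c' = 0 := by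
    ext i
    by_contra hi
    refine h0 (volume_eq_zero_of_ae_add_mem hLb'
      (d := coordReflection i (c - c') - (c - c')) ?_ ?_)
    · intro h
      have h2 := congrArg (fun v : EuclideanSpace ℝ (Fin n) => v i) h
      rw [sub_eq_zero] at h
      have h3 := congrArg (fun v : EuclideanSpace ℝ (Fin n) => v i) h
      simp only [coordReflection_same] at h3
      apply hi
      simp only [PiLp.zero_apply]
      linarith
    · filter_upwards [ae_add_right (-(c - c')) h1,
        ae_add_right (-(c - c')) (ae_coordReflection i h1)] with x h2 h3 hx
      rw [neg_add_cancel_right] at h2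
      rw [hLu.mem_iff] at h3
      have h4 := h3.1 (h2.2 hx)
      rw [← hLu'.mem_iff i, coordReflection_add, coordReflection_involutive] at h4
      rwa [add_sub, add_sub_right_comm, sub_eq_add_neg]
  rw [hd] at h1
  filter_upwards [h1] with x hx
  rw [add_zero] at hx
  exact propext hx

theorem smul_ae_eq {n : ℕ} {L L' : Set (EuclideanSpace ℝ (Fin n))} (h : L =ᵐ[volume] L')
    {r : ℝ} (hr : 0 < r) : (r • L : Set _) =ᵐ[volume] (r • L' : Set _) := by
  rw [← measure_symmDiff_eq_zero_iff] at h ⊢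
  rw [← Set.smul_set_symmDiff₀ hr.ne', volume_smul hr.le, h, mul_zero]

theorem IsOptimalShape.symmFun_ae_eq {n : ℕ} (hn : 1 ≤ n) {s : ℝ}
    {K L L' : Set (EuclideanSpace ℝ (Fin n))} (hL : IsOptimalShape s K L)
    (hL' : IsOptimalShape s K L') (h : L =ᵐ[volume] L')
    {f : EuclideanSpace ℝ (Fin n) → ℝ} (hf : Integrable f volume) :
    symmFun L f =ᵐ[volume] symmFun L' f := by
  have hset : ∀ t : ℝ, 0 < t →
      symmSet L {y | t < |f y|} =ᵐ[volume] symmSet L' {y | t < |f y|} := by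
    intro t ht
    have hfin := volume_superlevel_ne_top hf ht
    obtain ⟨r, hr0, h1, h2⟩ := hL.exists_symmSet_eq hn hfin
    have h1' : volume (r • L') = volume {y | t < |f y|} := by
      rw [← h1, volume_smul hr0, volume_smul hr0, measure_congr h]
    rw [h2, symmSet_eq_smul hn hL'.volume_ne_zero hL'.volume_ne_top hfin hr0 h1']
    rcases eq_or_lt_of_le hr0 with h3 | h3
    · have hz : ∀ A : Set (EuclideanSpace ℝ (Fin n)), volume (r • A) = 0 := fun A => by
        rw [volume_smul hr0, ← h3, zero_pow (by omega), ENNReal.ofReal_zero, zero_mul]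
      exact (ae_eq_empty.2 (hz L)).trans (ae_eq_empty.2 (hz L')).symm
    · exact smul_ae_eq h h3
  -- Rational levels suffice, by monotonicity in the level, and keep the exceptional set a countable
  -- union of null sets.
  have hq : ∀ᵐ x, ∀ q : ℚ, 0 < (q : ℝ) →
      (x ∈ symmSet L {y | (q : ℝ) < |f y|} ↔ x ∈ symmSet L' {y | (q : ℝ) < |f y|}) := by
    refine ae_all_iff.2 fun q => ?_
    by_cases hq0 : 0 < (q : ℝ)
    · filter_upwards [hset q hq0] with x hx _ using iff_of_eq hx
    · exact Filter.Eventually.of_forall fun x h => absurd h hq0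
  have hle : ∀ {A B : Set (EuclideanSpace ℝ (Fin n))}, IsOptimalShape s K A →
      ∀ {x : EuclideanSpace ℝ (Fin n)}, (∀ q : ℚ, 0 < (q : ℝ) →
        (x ∈ symmSet A {y | (q : ℝ) < |f y|} → x ∈ symmSet B {y | (q : ℝ) < |f y|})) →
      symmFun A f x ≤ symmFun B f x := by
    intro A B hA x hx
    refine le_of_forall_lt fun a ha => ?_
    have ha' : a ≠ ∞ := ha.ne_top
    rw [← ENNReal.ofReal_toReal ha'] at ha ⊢
    rw [lt_symmFun_iff ENNReal.toReal_nonneg] at ha ⊢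
    obtain ⟨τ, h1, h2⟩ := ha
    obtain ⟨q, hq1, hq2⟩ := exists_rat_btwn h1
    have hq0 : 0 < (q : ℝ) := ENNReal.toReal_nonneg.trans_lt hq1
    exact ⟨q, hq1, hx q hq0 (hA.antitone_symmSet hn hf hq0 hq2.le h2)⟩
  filter_upwards [hq] with x hx
  exact le_antisymm (hle hL fun q hq0 => (hx q hq0).1) (hle hL' fun q hq0 => (hx q hq0).2)

end FracPS

/-- Lebesgue measurability of the rearrangement takes the form of `AEMeasurable`. The use of
`toReal` in the seminorm can alter the rearrangement only at the origin, so it does not affect the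
integrals. -/
theorem mainTheorem2 (n : ℕ) (hn : 1 ≤ n) (s : ℝ) (hs0 : 0 < s) (hs1 : s < 1)
    (K : Set (EuclideanSpace ℝ (Fin n))) (hK : FracPS.IsConvexBody K)
    (hKstrict : StrictConvex ℝ K) (hKunc : FracPS.IsUnconditional K)
    (M : Set (EuclideanSpace ℝ (Fin n))) (hM : FracPS.IsMinimizer s K M) :
    -- up to translation and null sets, `M` is an unconditional star body
    (∃ L : Set (EuclideanSpace ℝ (Fin n)),
      FracPS.IsStarBody L ∧ FracPS.IsUnconditional L ∧ FracPS.EquivTranslate M L) ∧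
    -- the rearrangement does not depend on the unconditional star body representing `M`
    (∀ L L' : Set (EuclideanSpace ℝ (Fin n)),
      FracPS.IsStarBody L → FracPS.IsUnconditional L → FracPS.EquivTranslate M L →
      FracPS.IsStarBody L' → FracPS.IsUnconditional L' → FracPS.EquivTranslate M L' →
      ∀ f : EuclideanSpace ℝ (Fin n) → ℝ, Integrable f volume →
        FracPS.symmFun L f =ᵐ[volume] FracPS.symmFun L' f) ∧
    -- for every star body representing `M`: existence of the rearrangement, and the inequality
    (∀ L : Set (EuclideanSpace ℝ (Fin n)),
      FracPS.IsStarBody L → FracPS.EquivTranslate M L →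
      (∀ E : Set (EuclideanSpace ℝ (Fin n)), volume E ≠ ∞ →
        ∃! r : ℝ, 0 ≤ r ∧ volume (r • L) = volume E) ∧
      ∀ f : EuclideanSpace ℝ (Fin n) → ℝ, Integrable f volume →
        (∀ x, x ≠ 0 → FracPS.symmFun L f x < ∞) ∧
        AEMeasurable (FracPS.symmFun L f) volume ∧
        FracPS.fracSeminorm s K (fun x => (FracPS.symmFun L f x).toReal) ≤
          FracPS.fracSeminorm s K f) := by
  refine ⟨hM.exists_isStarBody hs0 hs1 hK hKunc hKstrict, ?_, ?_⟩
  · intro L L' hL hLu hML hL' hLu' hML' f hf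
    have hopt' := hM.isOptimalShape hL' hML'
    exact (hM.isOptimalShape hL hML).symmFun_ae_eq hn hopt'
      (FracPS.ae_eq_of_equivTranslate hLu hML hLu' hL'.isBounded hopt'.volume_ne_zero hML') hf
  · intro L hL hML
    have hopt := hM.isOptimalShape hL hML
    refine ⟨fun E hE => FracPS.existsUnique_volume_smul_eq hn hopt.volume_ne_zero
      hopt.volume_ne_top hE, fun f hf => ⟨fun x hx => hopt.symmFun_lt_top hn hf hx,
      hopt.aemeasurable_symmFun hn hf, hopt.fracSeminorm_symmFun_le hn hs0 hs1 hK hKunc hf⟩⟩
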